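/- **Setting.** Let $x^{\alpha\dot\alpha}$ ($\alpha,\dot\alpha=1,2$) be coordinates on Euclidean $\mathbb R^4$ with $x^{22}=\overline{x^{11}}$, $x^{21}=-\overline{x^{12}}$, and let $\lambda=(\lambda_{\dot\alpha})$, $\mu=(\mu_\alpha)$ be homogeneous coordinates on $\mathbb CP^1\times\mathbb CP^1$. Put $\hat s:=(-\overline{s_2},\overline{s_1})$ for $s=\lambda,\mu$; raise indices by $s^\alpha=\varepsilon^{\alpha\beta}s_\beta$ with $\varepsilon_{12}=1$, $\varepsilon_{\alpha\gamma}\varepsilon^{\gamma\beta}=\delta_\alpha{}^\beta$; and set $|s|^2:=s_\alpha\hat s^\alpha$. Let $F=\mathbb R^{4}\times\mathbb C^{0|12}\times\mathbb CP^1\times\mathbb CP^1$ with anticommuting coordinates $\eta^{\dot\alpha}_i,\theta^{i\alpha}$ ($i=1,2,3$). Functions on $F$ are polynomials in $\eta^{\dot\alpha}_i,\theta^{i\alpha}$ (not in their conjugates) whose coefficients are smooth complex functions on $\mathbb R^4\times\mathbb CP^1\times\mathbb CP^1$. Write $\eta_i:=\eta^{\dot\alpha}_i\lambda_{\dot\alpha}$,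 $\theta^i:=\theta^{i\alpha}\mu_\alpha$ and $$\hat E_F=\mu^\alpha\lambda^{\dot\alpha}\tfrac{\partial}{\partial x^{\alpha\dot\alpha}},\quad \hat E_L=|\lambda|^2\lambda_{\dot\alpha}\tfrac{\partial}{\partial\hat\lambda_{\dot\alpha}},\quad \hat E_R=|\mu|^2\mu_\alpha\tfrac{\partial}{\partial\hat\mu_\alpha},\quad E_W=\tfrac{\mu^\alpha\hat\lambda^{\dot\alpha}}{|\lambda|^2}\tfrac{\partial}{\partial x^{\alpha\dot\alpha}},\quad E_{\hat W}=-\tfrac{\hat\mu^\alpha\lambda^{\dot\alpha}}{|\mu|^2}\tfrac{\partial}{\partial x^{\alpha\dot\alpha}},$$ $$\hat V_F=\hat E_F,\quad \hat V_L=\hat E_L+\theta^i\eta_iE_{\hat W},\quad \hat V_R=\hat E_R+\theta^i\eta_iE_W,\quad \hat V^i=\lambda^{\dot\alpha}\tfrac{\partial}{\partial\eta^{\dot\alpha}_i},\quad \hat V_i=\mu^\alpha\tfrac{\partial}{\partial\theta^{i\alpha}}.$$ The only non-vanishing supercommutator of these fields is $[\hat V_L,\hat V_R]=2\theta^i\eta_i\hat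 V_F$. **The two differential graded Lie (super)algebras.** Let $\hat v^F,\hat v^L,\hat v^R$ (bosonic) and $\hat v_i,\hat v^i$ (fermionic) be the one-forms dual to $\hat V_F,\hat V_L,\hat V_R,\hat V^i,\hat V_i$, and let $\Omega^{0,\bullet}_{\rm tw}(F)$ be the graded algebra of globally defined forms (of homogeneity zero in $\lambda$ and in $\mu$) generated by these one-forms over the functions. Its product satisfies $\alpha\beta=(-1)^{pq+ab}\beta\alpha$ for $\alpha,\beta$ of form degrees $p,q$ and parities $a,b$. Its differential is $$\bar\partial_{\rm tw}=\hat v^F\hat V_F+\hat v^L\hat V_L+\hat v^R\hat V_R+\hat v_i\hat V^i+\hat v^i\hat V_i,$$ where $\hat v^F\mapsto-2\,\hat v^L\hat v^R\,\theta^i\eta_i$ and all other basis one-forms are closed. Let $\Omega^{0,\bullet}_{\rm tw,red}(F)\subseteq\Omega^{0,\bullet}_{\rm tw}(F)$ be the graded subalgebra generated by only the bosonic one-forms $\hat v^F,\hat v^L,\hat v^R$ and with coefficient functions depending on the fermionic coordinates only through $\eta_i$ and $\theta^i$, with differential $\bar\partial_{\rm tw,red}=\hat v^F\hat V_F+\hat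 v^L\hat V_L+\hat v^R\hat V_R$. For a complex Lie algebra $\mathfrak g$, let $$\mathfrak L_{\rm CR,tw}=\big(\Omega^{0,\bullet}_{\rm tw}(F)\otimes\mathfrak g,\ \bar\partial_{\rm tw},\ [-,-]\big),\qquad \mathfrak L_{\rm CR,tw,red}=\big(\Omega^{0,\bullet}_{\rm tw,red}(F)\otimes\mathfrak g,\ \bar\partial_{\rm tw,red},\ [-,-]\big),$$ with $[\alpha\otimes u,\beta\otimes v]=\alpha\beta\otimes[u,v]$. **Proposition.** For every complex Lie algebra $\mathfrak g$, the differential graded Lie algebras $\mathfrak L_{\rm CR,tw}$ and $\mathfrak L_{\rm CR,tw,red}$ are quasi-isomorphic. More precisely, the inclusion $\mathfrak L_{\rm CR,tw,red}\hookrightarrow\mathfrak L_{\rm CR,tw}$ is a morphism of differential graded Lie algebras which induces isomorphisms on all cohomology groups. -/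

import Mathlib

open scoped TensorProduct ContDiff

universe u

noncomputable section

namespace CRAmbitwistor

/-! ### Smooth functions on the cone over the body -/

/-- The ambient space of triples `(x, lam, mu)`.  The first entry `(x¹¹, x¹²)` is a point of
Euclidean `ℝ⁴ = ℂ²`; the remaining matrix entries are `x²² = conj x¹¹` and `x²¹ = - conj x¹²`.
The other two entries are the homogeneous coordinates on the two projective lines. -/
abbrev Ambient : Type := (Fin 2 → ℂ) × (Fin 2 → ℂ) × (Fin 2 → ℂ)

/-- The cone `ℝ⁴ × (ℂ² ∖ 0) × (ℂ² ∖ 0)` over `ℝ⁴ × ℂP¹ × ℂP¹`. -/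
def cone : Set Ambient := {p | p.2.1 ≠ 0 ∧ p.2.2 ≠ 0}

theorem isOpen_cone : IsOpen cone :=
  (isOpen_ne.preimage (by fun_prop : Continuous fun p : Ambient => p.2.1)).inter
    (isOpen_ne.preimage (by fun_prop : Continuous fun p : Ambient => p.2.2))

/-- Extension by zero of a function on the cone to the ambient space. -/
def ext0 (f : cone → ℂ) : Ambient → ℂ := Function.extend Subtype.val f 0

theorem ext0_coe (f : cone → ℂ) (p : cone) : ext0 f p = f p :=
  Subtype.val_injective.extend_apply f 0 p

theorem ext0_eqOn (f : cone → ℂ) {g : Ambient → ℂ} (h : ∀ p : cone, f p = g p) :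
    Set.EqOn (ext0 f) g cone := fun p hp => by
  rw [← h ⟨p, hp⟩]; exact ext0_coe f ⟨p, hp⟩

theorem ext0_eventuallyEq (f : cone → ℂ) {g : Ambient → ℂ} (h : ∀ p : cone, f p = g p) (p : cone) :
    ext0 f =ᶠ[nhds (p : Ambient)] g :=
  (ext0_eqOn f h).eventuallyEq_of_mem (isOpen_cone.mem_nhds p.2)

/-- Smooth complex-valued functions on the cone. -/
def Smooth : Subalgebra ℂ (cone → ℂ) where
  carrier := {f | ContDiffOn ℝ ∞ (ext0 f) cone}
  mul_mem' {f g} hf hg := (ContDiffOn.mul hf hg).congr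
    (ext0_eqOn _ fun p => by simp [ext0_coe])
  add_mem' {f g} hf hg := (ContDiffOn.add hf hg).congr
    (ext0_eqOn _ fun p => by simp [ext0_coe])
  algebraMap_mem' c := (contDiffOn_const (c := c)).congr
    (ext0_eqOn _ fun p => by simp)

theorem mem_smooth {f : cone → ℂ} : f ∈ Smooth ↔ ContDiffOn ℝ ∞ (ext0 f) cone := Iff.rfl

theorem mem_smooth_of {f : cone → ℂ} {g : Ambient → ℂ} (hg : ContDiffOn ℝ ∞ g cone)
    (h : ∀ p : cone, f p = g p) : f ∈ Smooth :=
  hg.congr (ext0_eqOn f h)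

theorem smooth_contDiffAt (f : Smooth) (p : cone) : ContDiffAt ℝ ∞ (ext0 f) p :=
  (mem_smooth.1 f.2).contDiffAt (isOpen_cone.mem_nhds p.2)

theorem smooth_differentiableAt (f : Smooth) (p : cone) : DifferentiableAt ℝ (ext0 f) p :=
  (smooth_contDiffAt f p).differentiableAt (by simp)

/-- The derivative of smooth functions on the cone in a real direction `v`. -/
def dirDer (v : Ambient) : Derivation ℂ Smooth Smooth :=
  Derivation.mk'
    { toFun := fun f => ⟨fun p => fderiv ℝ (ext0 f) p v,
        mem_smooth_of (((mem_smooth.1 f.2).fderiv_of_isOpen isOpen_cone (m := ∞) (by simp)).clm_apply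
          contDiffOn_const) fun _ => rfl⟩
      map_add' := fun f g => by
        ext p
        have h : ext0 (f + g : Smooth) =ᶠ[nhds (p : Ambient)] ext0 f + ext0 g :=
          ext0_eventuallyEq _ (fun q => by simp [ext0_coe]) p
        simp only [h.fderiv_eq]
        rw [fderiv_add (smooth_differentiableAt f p) (smooth_differentiableAt g p)]
        rfl
      map_smul' := fun c f => by
        ext p
        have h : ext0 (c • f : Smooth) =ᶠ[nhds (p : Ambient)] c • ext0 f :=
          ext0_eventuallyEq _ (fun q => by simp [ext0_coe]) p
        simp only [h.fderiv_eq]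
        rw [fderiv_const_smul (smooth_differentiableAt f p)]
        rfl }
    (fun f g => by
        ext p
        have h : ext0 (f * g : Smooth) =ᶠ[nhds (p : Ambient)] ext0 f * ext0 g :=
          ext0_eventuallyEq _ (fun q => by simp [ext0_coe]) p
        simp only [LinearMap.coe_mk, AddHom.coe_mk, h.fderiv_eq]
        rw [fderiv_mul (smooth_differentiableAt f p) (smooth_differentiableAt g p)]
        simp [ext0_coe])

theorem dirDer_apply (v : Ambient) (f : Smooth) (p : cone) :
    (dirDer v f : cone → ℂ) p = fderiv ℝ (ext0 f) p v := rfl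

theorem two_le_infty : (2 : ℕ∞ω) ≤ ∞ :=
  WithTop.coe_le_coe.2 (le_top : (2 : ℕ∞) ≤ ⊤)

theorem dirDer_comm (v w : Ambient) (f : Smooth) :
    dirDer v (dirDer w f) = dirDer w (dirDer v f) := by
  have key : ∀ (v w : Ambient) (p : cone), (dirDer v (dirDer w f) : cone → ℂ) p
      = fderiv ℝ (fderiv ℝ (ext0 f)) p v w := fun v w p => by
    have h : ext0 (dirDer w f : Smooth) =ᶠ[nhds (p : Ambient)]
        fun q => fderiv ℝ (ext0 f) q w :=
      ext0_eventuallyEq _ (g := fun q => fderiv ℝ (ext0 f) q w) (fun q => rfl) p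
    rw [dirDer_apply, h.fderiv_eq, fderiv_clm_apply]
    · simp
    · exact ((smooth_contDiffAt f p).fderiv_right (m := 1) (by rw [one_add_one_eq_two]; exact two_le_infty)).differentiableAt (by simp)
    · exact differentiableAt_const _
  ext p
  rw [key, key]
  exact (((smooth_contDiffAt f p).isSymmSndFDerivAt (by simpa using two_le_infty)).eq _ _)

/-- The holomorphic Wirtinger derivative in the direction of a vector of the complex ambient space. -/
def wirt (v : Ambient) : Derivation ℂ Smooth Smooth :=
  (1 / 2 : ℂ) • (dirDer v - Complex.I • dirDer (Complex.I • v))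

/-- The anti-holomorphic Wirtinger derivative. -/
def wirtBar (v : Ambient) : Derivation ℂ Smooth Smooth :=
  (1 / 2 : ℂ) • (dirDer v + Complex.I • dirDer (Complex.I • v))

/-- The unit vectors in the `x`-directions. -/
def exX (k : Fin 2) : Ambient := (Pi.single k 1, 0, 0)

/-- The unit vectors in the `lam`-directions. -/
def exL (k : Fin 2) : Ambient := (0, Pi.single k 1, 0)

/-- The unit vectors in the `mu`-directions. -/
def exM (k : Fin 2) : Ambient := (0, 0, Pi.single k 1)

/-- `∂/∂x^{α α'}`, using `x²² = conj x¹¹` and `x²¹ = - conj x¹²` (index `0` stands for `1` and index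
`1` for `2`). -/
def dX : Fin 2 → Fin 2 → Derivation ℂ Smooth Smooth :=
  !![wirt (exX 0), wirt (exX 1); -wirtBar (exX 1), wirtBar (exX 0)]

/-- `∂/∂(lamHat_α)`, where `lamHat = (- conj lam₂, conj lam₁)`. -/
def dLamHat : Fin 2 → Derivation ℂ Smooth Smooth := ![-wirtBar (exL 1), wirtBar (exL 0)]

/-- `∂/∂(muHat_α)`, where `muHat = (- conj mu₂, conj mu₁)`. -/
def dMuHat : Fin 2 → Derivation ℂ Smooth Smooth := ![-wirtBar (exM 1), wirtBar (exM 0)]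

/-- The homogeneous coordinates `lam_α` as functions. -/
def lam (k : Fin 2) : Smooth :=
  ⟨fun p => p.1.2.1 k, mem_smooth_of (g := fun p => p.2.1 k) (by fun_prop) fun _ => rfl⟩

/-- The homogeneous coordinates `mu_α` as functions. -/
def mu (k : Fin 2) : Smooth :=
  ⟨fun p => p.1.2.2 k, mem_smooth_of (g := fun p => p.2.2 k) (by fun_prop) fun _ => rfl⟩

/-- Complex conjugation of smooth functions. -/
def conjS (f : Smooth) : Smooth :=
  ⟨fun p => starRingEnd ℂ ((f : cone → ℂ) p),
    mem_smooth_of (g := fun p => Complex.conjCLE (ext0 f p))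
      (Complex.conjCLE.contDiff.comp_contDiffOn (mem_smooth.1 f.2))
      fun p => by simp [ext0_coe]⟩

/-- The quaternionic structure `(s₁, s₂) ↦ (- conj s₂, conj s₁)`. -/
def hat (s : Fin 2 → Smooth) : Fin 2 → Smooth := ![-conjS (s 1), conjS (s 0)]

/-- Raising an index, `s^α = ε^{αβ} s_β`, with `ε₁₂ = 1` and `ε_{αγ} ε^{γβ} = δ_α^β`, hence
`ε²¹ = 1 = - ε¹²`. -/
def up (s : Fin 2 → Smooth) : Fin 2 → Smooth := ![-s 1, s 0]

/-- The spinor norm `|s|² = s_α ŝ^α`. -/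
def nrm (s : Fin 2 → Smooth) : Smooth := ∑ k, s k * up (hat s) k

theorem nrm_apply (s : Fin 2 → Smooth) (p : cone) :
    (nrm s : cone → ℂ) p = -((‖(s 0 : cone → ℂ) p‖ ^ 2 + ‖(s 1 : cone → ℂ) p‖ ^ 2 : ℝ) : ℂ) := by
  have h : ∀ z : ℂ, z * starRingEnd ℂ z = ((‖z‖ ^ 2 : ℝ) : ℂ) := fun z => by
    rw [Complex.mul_conj, Complex.normSq_eq_norm_sq]
  simp [nrm, up, hat, conjS, Fin.sum_univ_two, h]
  ring

theorem nrm_ne (s : Fin 2 → Smooth) (p : cone) (h : ∃ k, (s k : cone → ℂ) p ≠ 0) :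
    (nrm s : cone → ℂ) p ≠ 0 := by
  rw [nrm_apply, neg_ne_zero, Complex.ofReal_ne_zero]
  obtain ⟨k, hk⟩ := h
  have := norm_pos_iff.2 hk
  fin_cases k <;> simp at this <;> positivity

theorem nrm_lam_ne (p : cone) : (nrm lam : cone → ℂ) p ≠ 0 :=
  nrm_ne _ _ (Function.ne_iff.1 p.2.1)

theorem nrm_mu_ne (p : cone) : (nrm mu : cone → ℂ) p ≠ 0 :=
  nrm_ne _ _ (Function.ne_iff.1 p.2.2)

/-- The inverse of a nowhere vanishing smooth function. -/
def invS (f : Smooth) (hf : ∀ p, (f : cone → ℂ) p ≠ 0) : Smooth :=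
  ⟨fun p => ((f : cone → ℂ) p)⁻¹, mem_smooth_of (g := fun p => (ext0 f p)⁻¹)
    (ContDiffOn.inv (mem_smooth.1 f.2) fun p hp => by rw [ext0_coe (f : cone → ℂ) ⟨p, hp⟩]; exact hf _)
    fun p => by simp [ext0_coe]⟩

theorem mul_invS (f : Smooth) (hf : ∀ p, (f : cone → ℂ) p ≠ 0) : f * invS f hf = 1 := by
  ext p; exact mul_inv_cancel₀ (hf p)

/-- `1 / |lam|²`. -/
def invLam : Smooth := invS (nrm lam) nrm_lam_ne

/-- `1 / |mu|²`. -/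
def invMu : Smooth := invS (nrm mu) nrm_mu_ne

/-! ### The bosonic vector fields, acting on functions of the bosonic coordinates -/

/-- `Ê_F = mu^α lam^α' ∂/∂x^{α α'}`. -/
def hEF : Derivation ℂ Smooth Smooth := ∑ a, ∑ b, (up mu a * up lam b) • dX a b

/-- `Ê_L = |lam|² lam_α ∂/∂(lamHat_α)`. -/
def hEL : Derivation ℂ Smooth Smooth := nrm lam • ∑ b, lam b • dLamHat b

/-- `Ê_R = |mu|² mu_α ∂/∂(muHat_α)`. -/
def hER : Derivation ℂ Smooth Smooth := nrm mu • ∑ a, mu a • dMuHat a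

/-- `E_W = mu^α lamHat^α' / |lam|² ∂/∂x^{α α'}`. -/
def eW : Derivation ℂ Smooth Smooth :=
  ∑ a, ∑ b, (up mu a * up (hat lam) b * invLam) • dX a b

/-- `E_Ŵ = - muHat^α lam^α' / |mu|² ∂/∂x^{α α'}`. -/
def eWhat : Derivation ℂ Smooth Smooth :=
  -∑ a, ∑ b, (up (hat mu) a * up lam b * invMu) • dX a b

/-! ### Relations among the bosonic vector fields -/

theorem dirDer_lam (v : Ambient) (k : Fin 2) : dirDer v (lam k) = algebraMap ℂ Smooth (v.2.1 k) := by
  ext p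
  let g : Ambient →L[ℝ] ℂ := (ContinuousLinearMap.proj k).comp
    ((ContinuousLinearMap.fst ℝ _ _).comp (ContinuousLinearMap.snd ℝ _ _))
  have h : ext0 (lam k : Smooth) =ᶠ[nhds (p : Ambient)] g :=
    ext0_eventuallyEq _ (g := g) (fun _ => rfl) p
  rw [dirDer_apply, h.fderiv_eq, ContinuousLinearMap.fderiv]
  rfl

theorem dirDer_mu (v : Ambient) (k : Fin 2) : dirDer v (mu k) = algebraMap ℂ Smooth (v.2.2 k) := by
  ext p
  let g : Ambient →L[ℝ] ℂ := (ContinuousLinearMap.proj k).comp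
    ((ContinuousLinearMap.snd ℝ _ _).comp (ContinuousLinearMap.snd ℝ _ _))
  have h : ext0 (mu k : Smooth) =ᶠ[nhds (p : Ambient)] g :=
    ext0_eventuallyEq _ (g := g) (fun _ => rfl) p
  rw [dirDer_apply, h.fderiv_eq, ContinuousLinearMap.fderiv]
  rfl

theorem dirDer_conjS (v : Ambient) (f : Smooth) : dirDer v (conjS f) = conjS (dirDer v f) := by
  ext p
  have h : ext0 (conjS f : Smooth) =ᶠ[nhds (p : Ambient)] fun q => Complex.conjCLE (ext0 f q) :=
    ext0_eventuallyEq _ (fun q => by simp [ext0_coe, conjS]) p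
  have h2 : HasFDerivAt (fun q => Complex.conjCLE (ext0 f q))
      ((Complex.conjCLE : ℂ →L[ℝ] ℂ).comp (fderiv ℝ (ext0 f) p)) (p : Ambient) :=
    (Complex.conjCLE : ℂ →L[ℝ] ℂ).hasFDerivAt.comp _ (smooth_differentiableAt f p).hasFDerivAt
  rw [dirDer_apply, h.fderiv_eq, h2.fderiv]
  rfl

theorem conjS_algebraMap (c : ℂ) :
    conjS (algebraMap ℂ Smooth c) = algebraMap ℂ Smooth (starRingEnd ℂ c) := by
  ext p; rfl

theorem wirt_apply (v : Ambient) (f : Smooth) :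
    wirt v f = (1 / 2 : ℂ) • (dirDer v f - Complex.I • dirDer (Complex.I • v) f) := rfl

theorem wirtBar_apply (v : Ambient) (f : Smooth) :
    wirtBar v f = (1 / 2 : ℂ) • (dirDer v f + Complex.I • dirDer (Complex.I • v) f) := rfl

/-- Two derivations commute. -/
def Comm (D D' : Derivation ℂ Smooth Smooth) : Prop := ∀ f, D (D' f) = D' (D f)

theorem Comm.symm {D D' : Derivation ℂ Smooth Smooth} (h : Comm D D') : Comm D' D :=
  fun f => (h f).symm

theorem Comm.sum {ι : Type*} {s : Finset ι} {D : Derivation ℂ Smooth Smooth}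
    {D' : ι → Derivation ℂ Smooth Smooth} (h : ∀ i ∈ s, Comm D (D' i)) : Comm D (∑ i ∈ s, D' i) := by
  classical
  induction s using Finset.induction_on with
  | empty => intro f; simp
  | insert a s ha ih =>
    rw [Finset.sum_insert ha]
    intro f
    have h1 := h a (by simp) f
    have h2 := ih (fun i hi => h i (by simp [hi])) f
    simp only [Derivation.add_apply, map_add, h1, h2]

theorem Comm.neg {D D₁ : Derivation ℂ Smooth Smooth} (h₁ : Comm D D₁) : Comm D (-D₁) :=
  fun f => by simp [h₁ f]

theorem Comm.fsmul {D D₁ : Derivation ℂ Smooth Smooth} {g : Smooth} (hg : D g = 0)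
    (h₁ : Comm D D₁) : Comm D (g • D₁) := fun f => by simp [h₁ f, hg]

/-- Derivations with constant coefficients. -/
def constDer : Submodule ℂ (Derivation ℂ Smooth Smooth) := Submodule.span ℂ (Set.range dirDer)

theorem comm_const {D D' : Derivation ℂ Smooth Smooth} (h : D ∈ constDer) (h' : D' ∈ constDer) :
    Comm D D' := by
  induction h, h' using Submodule.span_induction₂ with
  | mem_mem x y hx hy =>
    obtain ⟨v, rfl⟩ := hx
    obtain ⟨w, rfl⟩ := hy
    exact fun f => dirDer_comm v w f
  | zero_left => intro f; simp
  | zero_right => intro f; simp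
  | add_left x y z _ _ _ h₁ h₂ => intro f; simp [h₁ f, h₂ f]
  | add_right x y z _ _ _ h₁ h₂ => intro f; simp [h₁ f, h₂ f]
  | smul_left r x y _ _ h => intro f; simp [h f]
  | smul_right r x y _ _ h => intro f; simp [h f]

theorem dirDer_mem (v : Ambient) : dirDer v ∈ constDer := Submodule.subset_span ⟨v, rfl⟩

theorem wirt_mem (v : Ambient) : wirt v ∈ constDer := by
  have h : wirt v = (1 / 2 : ℂ) • (dirDer v + (-Complex.I) • dirDer (Complex.I • v)) := by
    ext f : 1
    simp [wirt_apply, sub_eq_add_neg]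
  rw [h]
  exact constDer.smul_mem _ (constDer.add_mem (dirDer_mem _) (constDer.smul_mem _ (dirDer_mem _)))

theorem neg_wirtBar_mem (v : Ambient) : -wirtBar v ∈ constDer := by
  have h : -wirtBar v = (-1 / 2 : ℂ) • (dirDer v + Complex.I • dirDer (Complex.I • v)) := by
    ext f : 1
    simp [wirtBar_apply, neg_div]
    exact add_comm _ _
  rw [h]
  exact constDer.smul_mem _ (constDer.add_mem (dirDer_mem _) (constDer.smul_mem _ (dirDer_mem _)))

theorem wirtBar_mem (v : Ambient) : wirtBar v ∈ constDer :=
  constDer.smul_mem _ (constDer.add_mem (dirDer_mem _) (constDer.smul_mem _ (dirDer_mem _)))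

theorem dX_mem (a b : Fin 2) : dX a b ∈ constDer := by
  fin_cases a <;> fin_cases b
  · exact wirt_mem _
  · exact wirt_mem _
  · exact neg_wirtBar_mem _
  · exact wirtBar_mem _

theorem dLamHat_mem (b : Fin 2) : dLamHat b ∈ constDer := by
  fin_cases b
  · exact neg_wirtBar_mem _
  · exact wirtBar_mem _

theorem dMuHat_mem (b : Fin 2) : dMuHat b ∈ constDer := by
  fin_cases b
  · exact neg_wirtBar_mem _
  · exact wirtBar_mem _

theorem conjS_zero : conjS 0 = 0 := by ext p; simp [conjS]

theorem wirt_lam (v : Ambient) (k : Fin 2) : wirt v (lam k) = algebraMap ℂ Smooth (v.2.1 k) := by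
  rw [wirt_apply, dirDer_lam, dirDer_lam]
  ext p
  change (1 / 2 : ℂ) * (v.2.1 k - Complex.I * (Complex.I * v.2.1 k)) = v.2.1 k
  linear_combination (-1 / 2 * v.2.1 k) * Complex.I_mul_I

theorem wirt_mu (v : Ambient) (k : Fin 2) : wirt v (mu k) = algebraMap ℂ Smooth (v.2.2 k) := by
  rw [wirt_apply, dirDer_mu, dirDer_mu]
  ext p
  change (1 / 2 : ℂ) * (v.2.2 k - Complex.I * (Complex.I * v.2.2 k)) = v.2.2 k
  linear_combination (-1 / 2 * v.2.2 k) * Complex.I_mul_I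

theorem wirtBar_lam (v : Ambient) (k : Fin 2) : wirtBar v (lam k) = 0 := by
  rw [wirtBar_apply, dirDer_lam, dirDer_lam]
  ext p
  change (1 / 2 : ℂ) * (v.2.1 k + Complex.I * (Complex.I * v.2.1 k)) = 0
  linear_combination (1 / 2 * v.2.1 k) * Complex.I_mul_I

theorem wirtBar_mu (v : Ambient) (k : Fin 2) : wirtBar v (mu k) = 0 := by
  rw [wirtBar_apply, dirDer_mu, dirDer_mu]
  ext p
  change (1 / 2 : ℂ) * (v.2.2 k + Complex.I * (Complex.I * v.2.2 k)) = 0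
  linear_combination (1 / 2 * v.2.2 k) * Complex.I_mul_I

theorem conjS_smul (c : ℂ) (f : Smooth) : conjS (c • f) = starRingEnd ℂ c • conjS f := by
  ext p; exact map_mul (starRingEnd ℂ) _ _

theorem conjS_add (f g : Smooth) : conjS (f + g) = conjS f + conjS g := by
  ext p; exact map_add (starRingEnd ℂ) _ _

theorem conjS_sub (f g : Smooth) : conjS (f - g) = conjS f - conjS g := by
  ext p; exact map_sub (starRingEnd ℂ) _ _

theorem conj_half : starRingEnd ℂ (1 / 2) = 1 / 2 := by
  simp [Complex.conj_ofNat]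

theorem wirt_conjS (v : Ambient) (f : Smooth) : wirt v (conjS f) = conjS (wirtBar v f) := by
  rw [wirt_apply, wirtBar_apply, dirDer_conjS, dirDer_conjS, conjS_smul, conjS_add, conjS_smul,
    conj_half, Complex.conj_I, neg_smul, sub_eq_add_neg]

theorem wirtBar_conjS (v : Ambient) (f : Smooth) : wirtBar v (conjS f) = conjS (wirt v f) := by
  rw [wirt_apply, wirtBar_apply, dirDer_conjS, dirDer_conjS, conjS_smul, conjS_sub, conjS_smul,
    conj_half, Complex.conj_I, neg_smul, sub_neg_eq_add]

theorem dX_lam (a b k : Fin 2) : dX a b (lam k) = 0 := by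
  fin_cases a <;> fin_cases b <;> simp [dX, wirt_lam, wirtBar_lam, exX]

theorem dX_mu (a b k : Fin 2) : dX a b (mu k) = 0 := by
  fin_cases a <;> fin_cases b <;> simp [dX, wirt_mu, wirtBar_mu, exX]

theorem dX_hat_lam (a b k : Fin 2) : dX a b (hat lam k) = 0 := by
  fin_cases a <;> fin_cases b <;> fin_cases k <;>
    simp [dX, hat, wirt_conjS, wirtBar_conjS, wirt_lam, wirtBar_lam, exX, conjS_zero]

theorem dX_hat_mu (a b k : Fin 2) : dX a b (hat mu k) = 0 := by
  fin_cases a <;> fin_cases b <;> fin_cases k <;>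
    simp [dX, hat, wirt_conjS, wirtBar_conjS, wirt_mu, wirtBar_mu, exX, conjS_zero]

theorem dLamHat_lam (b k : Fin 2) : dLamHat b (lam k) = 0 := by
  fin_cases b <;> simp [dLamHat, wirtBar_lam]

theorem dLamHat_mu (b k : Fin 2) : dLamHat b (mu k) = 0 := by
  fin_cases b <;> simp [dLamHat, wirtBar_mu]

theorem dMuHat_lam (b k : Fin 2) : dMuHat b (lam k) = 0 := by
  fin_cases b <;> simp [dMuHat, wirtBar_lam]

theorem dMuHat_mu (b k : Fin 2) : dMuHat b (mu k) = 0 := by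
  fin_cases b <;> simp [dMuHat, wirtBar_mu]

theorem conjS_one : conjS 1 = 1 := by ext p; simp [conjS]

theorem dLamHat_hat_lam (b k : Fin 2) : dLamHat b (hat lam k) = if b = k then 1 else 0 := by
  fin_cases b <;> fin_cases k <;>
    simp [dLamHat, hat, wirtBar_conjS, wirt_lam, exL, conjS_zero, conjS_one]

theorem dLamHat_hat_mu (b k : Fin 2) : dLamHat b (hat mu k) = 0 := by
  fin_cases b <;> fin_cases k <;>
    simp [dLamHat, hat, wirtBar_conjS, wirt_mu, exL, conjS_zero]

theorem dMuHat_hat_mu (b k : Fin 2) : dMuHat b (hat mu k) = if b = k then 1 else 0 := by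
  fin_cases b <;> fin_cases k <;>
    simp [dMuHat, hat, wirtBar_conjS, wirt_mu, exM, conjS_zero, conjS_one]

theorem dMuHat_hat_lam (b k : Fin 2) : dMuHat b (hat lam k) = 0 := by
  fin_cases b <;> fin_cases k <;>
    simp [dMuHat, hat, wirtBar_conjS, wirt_lam, exM, conjS_zero]

/-- Combinations of the translations `∂/∂x^{α α'}` with given coefficients. -/
def transl (c : Fin 2 → Fin 2 → Smooth) : Derivation ℂ Smooth Smooth := ∑ a, ∑ b, c a b • dX a b

theorem transl_apply (c : Fin 2 → Fin 2 → Smooth) (f : Smooth) :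
    transl c f = ∑ a, ∑ b, c a b * dX a b f := by
  simp [transl, Fin.sum_univ_two]

theorem hEF_eq : hEF = transl fun a b => up mu a * up lam b := rfl

theorem eW_eq : eW = transl fun a b => up mu a * up (hat lam) b * invLam := rfl

theorem eWhat_eq : eWhat = transl fun a b => -(up (hat mu) a * up lam b * invMu) := by
  ext f : 1
  simp only [eWhat, transl_apply, Derivation.neg_apply, Fin.sum_univ_two, Derivation.add_apply,
    Derivation.smul_apply, smul_eq_mul]
  ring

theorem up_zero (s : Fin 2 → Smooth) : up s 0 = -s 1 := rfl
theorem up_one (s : Fin 2 → Smooth) : up s 1 = s 0 := rfl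

theorem der_up (D : Derivation ℂ Smooth Smooth) (s : Fin 2 → Smooth) (k : Fin 2) :
    D (up s k) = up (fun j => D (s j)) k := by
  fin_cases k <;> simp [up]

theorem der_nrm (D : Derivation ℂ Smooth Smooth) (s : Fin 2 → Smooth) :
    D (nrm s) = ∑ k, (D (s k) * up (hat s) k + s k * up (fun j => D (hat s j)) k) := by
  simp only [nrm, map_sum, Derivation.leibniz, der_up, smul_eq_mul]
  exact Finset.sum_congr rfl fun _ _ => by ring

theorem der_invS (D : Derivation ℂ Smooth Smooth) (f : Smooth) (hf) (h : D f = 0) :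
    D (invS f hf) = 0 := by
  have h1 : D (f * invS f hf) = 0 := by rw [mul_invS]; exact D.map_one_eq_zero
  rw [D.leibniz, h, smul_zero, add_zero, smul_eq_mul] at h1
  calc D (invS f hf) = (f * invS f hf) * D (invS f hf) := by rw [mul_invS, one_mul]
    _ = invS f hf * (f * D (invS f hf)) := by ring
    _ = 0 := by rw [h1, mul_zero]

theorem up_fun_zero (k : Fin 2) : up (fun _ => 0) k = 0 := by
  fin_cases k <;> simp [up]

theorem dX_nrm_lam (a b : Fin 2) : dX a b (nrm lam) = 0 := by
  simp [der_nrm, dX_lam, dX_hat_lam, up_fun_zero]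

theorem dX_nrm_mu (a b : Fin 2) : dX a b (nrm mu) = 0 := by
  simp [der_nrm, dX_mu, dX_hat_mu, up_fun_zero]

theorem dX_invLam (a b : Fin 2) : dX a b invLam = 0 := der_invS _ _ _ (dX_nrm_lam a b)

theorem dX_invMu (a b : Fin 2) : dX a b invMu = 0 := der_invS _ _ _ (dX_nrm_mu a b)

theorem transl_lam (c : Fin 2 → Fin 2 → Smooth) (k : Fin 2) : transl c (lam k) = 0 := by
  simp [transl_apply, dX_lam]

theorem transl_mu (c : Fin 2 → Fin 2 → Smooth) (k : Fin 2) : transl c (mu k) = 0 := by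
  simp [transl_apply, dX_mu]

theorem hEL_apply (f : Smooth) : hEL f = nrm lam * ∑ b, lam b * dLamHat b f := by
  simp [hEL, Fin.sum_univ_two, mul_add]

theorem hER_apply (f : Smooth) : hER f = nrm mu * ∑ b, mu b * dMuHat b f := by
  simp [hER, Fin.sum_univ_two, mul_add]

theorem hEL_lam (k : Fin 2) : hEL (lam k) = 0 := by simp [hEL_apply, dLamHat_lam]
theorem hEL_mu (k : Fin 2) : hEL (mu k) = 0 := by simp [hEL_apply, dLamHat_mu]
theorem hER_lam (k : Fin 2) : hER (lam k) = 0 := by simp [hER_apply, dMuHat_lam]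
theorem hER_mu (k : Fin 2) : hER (mu k) = 0 := by simp [hER_apply, dMuHat_mu]

theorem hEL_hat_lam (k : Fin 2) : hEL (hat lam k) = nrm lam * lam k := by
  simp [hEL_apply, dLamHat_hat_lam]

theorem hER_hat_mu (k : Fin 2) : hER (hat mu k) = nrm mu * mu k := by
  simp [hER_apply, dMuHat_hat_mu]

theorem hEL_hat_mu (k : Fin 2) : hEL (hat mu k) = 0 := by simp [hEL_apply, dLamHat_hat_mu]
theorem hER_hat_lam (k : Fin 2) : hER (hat lam k) = 0 := by simp [hER_apply, dMuHat_hat_lam]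

theorem hEL_nrm_lam : hEL (nrm lam) = 0 := by
  simp only [der_nrm, hEL_lam, hEL_hat_lam, Fin.sum_univ_two, up_zero, up_one]
  ring

theorem hER_nrm_mu : hER (nrm mu) = 0 := by
  simp only [der_nrm, hER_mu, hER_hat_mu, Fin.sum_univ_two, up_zero, up_one]
  ring

theorem hEL_nrm_mu : hEL (nrm mu) = 0 := by
  simp [der_nrm, hEL_mu, hEL_hat_mu, up_fun_zero]

theorem hER_nrm_lam : hER (nrm lam) = 0 := by
  simp [der_nrm, hER_lam, hER_hat_lam, up_fun_zero]

theorem hEL_invLam : hEL invLam = 0 := der_invS _ _ _ hEL_nrm_lam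
theorem hER_invMu : hER invMu = 0 := der_invS _ _ _ hER_nrm_mu

theorem comm_transl (c c' : Fin 2 → Fin 2 → Smooth) (hc : ∀ a b k l, dX k l (c a b) = 0)
    (hc' : ∀ a b k l, dX k l (c' a b) = 0) : Comm (transl c) (transl c') := by
  refine .sum fun a _ => .sum fun b _ => .fsmul (by simp [transl_apply, hc']) ?_
  exact Comm.symm <| .sum fun k _ => .sum fun l _ => .fsmul (hc _ _ _ _)
    (comm_const (dX_mem _ _) (dX_mem _ _))

theorem comm_dX_hEL (a b : Fin 2) : Comm (dX a b) hEL :=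
  .fsmul (dX_nrm_lam a b) <| .sum fun _ _ => .fsmul (dX_lam _ _ _)
    (comm_const (dX_mem _ _) (dLamHat_mem _))

theorem comm_dX_hER (a b : Fin 2) : Comm (dX a b) hER :=
  .fsmul (dX_nrm_mu a b) <| .sum fun _ _ => .fsmul (dX_mu _ _ _)
    (comm_const (dX_mem _ _) (dMuHat_mem _))

theorem comm_hEL_hER : Comm hEL hER :=
  .fsmul hEL_nrm_mu <| .sum fun _ _ => .fsmul (hEL_mu _) <| Comm.symm <|
    .fsmul (by simp [der_nrm, dMuHat_lam, dMuHat_hat_lam, up_fun_zero]) <| .sum fun _ _ =>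
      .fsmul (dMuHat_lam _ _) (comm_const (dMuHat_mem _) (dLamHat_mem _))

theorem hEL_transl (c : Fin 2 → Fin 2 → Smooth) (f : Smooth) :
    hEL (transl c f) = transl c (hEL f) + transl (fun a b => hEL (c a b)) f := by
  simp only [transl_apply, map_sum, Derivation.leibniz, smul_eq_mul, Finset.sum_add_distrib,
    (comm_dX_hEL _ _).symm f]
  simp only [mul_comm (dX _ _ f)]

theorem hER_transl (c : Fin 2 → Fin 2 → Smooth) (f : Smooth) :
    hER (transl c f) = transl c (hER f) + transl (fun a b => hER (c a b)) f := by
  simp only [transl_apply, map_sum, Derivation.leibniz, smul_eq_mul, Finset.sum_add_distrib,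
    (comm_dX_hER _ _).symm f]
  simp only [mul_comm (dX _ _ f)]

theorem invLam_mul : nrm lam * invLam = 1 := mul_invS _ _
theorem invMu_mul : nrm mu * invMu = 1 := mul_invS _ _

theorem up_mul_left (g : Smooth) (s : Fin 2 → Smooth) (k : Fin 2) :
    up (fun j => g * s j) k = g * up s k := by
  fin_cases k
  · exact (mul_neg g (s 1)).symm
  · rfl

theorem transl_zero : transl (fun _ _ => 0) = 0 := by simp [transl]

theorem hEL_hEF (f : Smooth) : hEL (hEF f) = hEF (hEL f) := by
  rw [hEF_eq, hEL_transl]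
  simp [Derivation.leibniz, der_up, hEL_lam, hEL_mu, up_fun_zero, transl_zero]

theorem hER_hEF (f : Smooth) : hER (hEF f) = hEF (hER f) := by
  rw [hEF_eq, hER_transl]
  simp [Derivation.leibniz, der_up, hER_lam, hER_mu, up_fun_zero, transl_zero]

theorem hEL_eW (f : Smooth) : hEL (eW f) = eW (hEL f) + hEF f := by
  rw [eW_eq, hEL_transl, hEF_eq]
  congr 3
  ext a b : 2
  simp only [Derivation.leibniz, der_up, hEL_hat_lam, hEL_mu, hEL_invLam, up_fun_zero, up_mul_left,
    smul_eq_mul, mul_zero, add_zero, zero_add]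
  linear_combination (up mu a * up lam b) * invLam_mul

theorem hER_eWhat (f : Smooth) : hER (eWhat f) = eWhat (hER f) - hEF f := by
  have h : transl (fun a b => hER (-(up (hat mu) a * up lam b * invMu))) = -hEF := by
    ext f : 1
    rw [hEF_eq, Derivation.neg_apply, transl_apply, transl_apply]
    simp only [← Finset.sum_neg_distrib]
    refine Finset.sum_congr rfl fun a _ => Finset.sum_congr rfl fun b _ => ?_
    simp only [Derivation.leibniz, der_up, hER_hat_mu, hER_lam, hER_invMu, up_fun_zero, up_mul_left,
      smul_eq_mul, mul_zero, zero_add, map_neg]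
    linear_combination -(up mu a * up lam b) * dX a b f * invMu_mul
  rw [eWhat_eq, hER_transl, h, Derivation.neg_apply, sub_eq_add_neg]

theorem dX_eW_coeff (a b k l : Fin 2) : dX k l (up mu a * up (hat lam) b * invLam) = 0 := by
  simp [Derivation.leibniz, der_up, dX_mu, dX_hat_lam, dX_invLam, up_fun_zero]

theorem dX_eWhat_coeff (a b k l : Fin 2) : dX k l (-(up (hat mu) a * up lam b * invMu)) = 0 := by
  simp [Derivation.leibniz, der_up, dX_lam, dX_hat_mu, dX_invMu, up_fun_zero]

theorem dX_hEF_coeff (a b k l : Fin 2) : dX k l (up mu a * up lam b) = 0 := by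
  simp [Derivation.leibniz, der_up, dX_lam, dX_mu, up_fun_zero]

theorem eW_eWhat (f : Smooth) : eW (eWhat f) = eWhat (eW f) := by
  rw [eW_eq, eWhat_eq]; exact comm_transl _ _ dX_eW_coeff dX_eWhat_coeff f

theorem eW_hEF (f : Smooth) : eW (hEF f) = hEF (eW f) := by
  rw [eW_eq, hEF_eq]; exact comm_transl _ _ dX_eW_coeff dX_hEF_coeff f

theorem eWhat_hEF (f : Smooth) : eWhat (hEF f) = hEF (eWhat f) := by
  rw [eWhat_eq, hEF_eq]; exact comm_transl _ _ dX_eWhat_coeff dX_hEF_coeff f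

theorem hEF_lam (k : Fin 2) : hEF (lam k) = 0 := by rw [hEF_eq]; exact transl_lam _ _
theorem hEF_mu (k : Fin 2) : hEF (mu k) = 0 := by rw [hEF_eq]; exact transl_mu _ _
theorem eW_lam (k : Fin 2) : eW (lam k) = 0 := by rw [eW_eq]; exact transl_lam _ _
theorem eW_mu (k : Fin 2) : eW (mu k) = 0 := by rw [eW_eq]; exact transl_mu _ _
theorem eWhat_lam (k : Fin 2) : eWhat (lam k) = 0 := by rw [eWhat_eq]; exact transl_lam _ _
theorem eWhat_mu (k : Fin 2) : eWhat (mu k) = 0 := by rw [eWhat_eq]; exact transl_mu _ _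

/-! ### Rescaling of the homogeneous coordinates -/

/-- `(x, lam, mu) ↦ (x, t lam, s mu)`. -/
def scaleL (t s : ℂ) : Ambient →L[ℂ] Ambient :=
  (ContinuousLinearMap.id ℂ _).prodMap
    ((t • ContinuousLinearMap.id ℂ _).prodMap (s • ContinuousLinearMap.id ℂ _))

theorem scaleL_apply (t s : ℂ) (p : Ambient) : scaleL t s p = (p.1, t • p.2.1, s • p.2.2) := rfl

theorem scaleL_mem (t s : ℂˣ) (p : cone) : scaleL t s p ∈ cone :=
  ⟨smul_ne_zero t.ne_zero p.2.1, smul_ne_zero s.ne_zero p.2.2⟩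

/-- Pull-back of functions along `(x, lam, mu) ↦ (x, t lam, s mu)`. -/
def scaleS (t s : ℂˣ) : Smooth →ₐ[ℂ] Smooth where
  toFun f := ⟨fun p => (f : cone → ℂ) ⟨scaleL t s p, scaleL_mem t s p⟩,
    mem_smooth_of (g := fun p => ext0 f (scaleL t s p))
      ((mem_smooth.1 f.2).comp ((scaleL t s).restrictScalars ℝ).contDiff.contDiffOn
        fun p hp => scaleL_mem t s ⟨p, hp⟩)
      fun p => (ext0_coe f ⟨_, scaleL_mem t s p⟩).symm⟩
  map_one' := rfl
  map_mul' _ _ := rfl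
  map_zero' := rfl
  map_add' _ _ := rfl
  commutes' _ := rfl

theorem dirDer_scaleS (t s : ℂˣ) (v : Ambient) (f : Smooth) :
    dirDer v (scaleS t s f) = scaleS t s (dirDer (scaleL t s v) f) := by
  ext p
  have h : ext0 (scaleS t s f : Smooth) =ᶠ[nhds (p : Ambient)] fun q => ext0 f (scaleL t s q) :=
    ext0_eventuallyEq _ (fun q => (ext0_coe f ⟨_, scaleL_mem t s q⟩).symm) p
  have h2 : HasFDerivAt (fun q => ext0 f (scaleL t s q))
      ((fderiv ℝ (ext0 f) (scaleL t s p)).comp ((scaleL t s).restrictScalars ℝ)) (p : Ambient) :=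
    (smooth_differentiableAt f ⟨_, scaleL_mem t s p⟩).hasFDerivAt.comp (p : Ambient)
      ((scaleL t s).restrictScalars ℝ).hasFDerivAt
  rw [dirDer_apply, h.fderiv_eq, h2.fderiv]
  rfl

theorem wirt_scaleS (t s : ℂˣ) (v : Ambient) (f : Smooth) :
    wirt v (scaleS t s f) = scaleS t s (wirt (scaleL t s v) f) := by
  simp only [wirt_apply, dirDer_scaleS, map_smul, map_sub]

theorem wirtBar_scaleS (t s : ℂˣ) (v : Ambient) (f : Smooth) :
    wirtBar v (scaleS t s f) = scaleS t s (wirtBar (scaleL t s v) f) := by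
  simp only [wirtBar_apply, dirDer_scaleS, map_smul, map_add]

theorem dirDer_add (v w : Ambient) (f : Smooth) : dirDer (v + w) f = dirDer v f + dirDer w f := by
  ext p; exact map_add (fderiv ℝ (ext0 f) p) v w

theorem dirDer_rsmul (c : ℝ) (v : Ambient) (f : Smooth) :
    dirDer ((c : ℂ) • v) f = (c : ℂ) • dirDer v f := by
  ext p
  have := map_smul (fderiv ℝ (ext0 f) p) c v
  rw [Complex.coe_smul, dirDer_apply, this]
  exact Complex.real_smul

theorem dirDer_csmul (c : ℂ) (v : Ambient) (f : Smooth) :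
    dirDer (c • v) f = (c.re : ℂ) • dirDer v f + (c.im : ℂ) • dirDer (Complex.I • v) f := by
  conv_lhs => rw [← Complex.re_add_im c, add_smul, mul_smul]
  rw [dirDer_add, dirDer_rsmul, dirDer_rsmul]

theorem wirtBar_csmul (c : ℂ) (v : Ambient) (f : Smooth) :
    wirtBar (c • v) f = starRingEnd ℂ c • wirtBar v f := by
  rw [wirtBar_apply, wirtBar_apply, smul_smul Complex.I c v,
    dirDer_csmul c, dirDer_csmul (Complex.I * c)]
  ext p
  set a := (dirDer v f : cone → ℂ) p with ha
  set b := (dirDer (Complex.I • v) f : cone → ℂ) p with hb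
  change (1 / 2 : ℂ) * ((c.re * a + c.im * b) + Complex.I * ((Complex.I * c).re * a +
    (Complex.I * c).im * b)) = starRingEnd ℂ c * ((1 / 2 : ℂ) * (a + Complex.I * b))
  have h : starRingEnd ℂ c = c.re - c.im * Complex.I := by
    apply Complex.ext <;> simp
  simp only [h, Complex.I_mul_re, Complex.I_mul_im, Complex.ofReal_neg]
  linear_combination (1 / 2 * c.im * b) * Complex.I_mul_I

theorem scaleS_lam (t s : ℂˣ) (k : Fin 2) : scaleS t s (lam k) = (t : ℂ) • lam k := rfl
theorem scaleS_mu (t s : ℂˣ) (k : Fin 2) : scaleS t s (mu k) = (s : ℂ) • mu k := rfl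
theorem scaleS_conjS (t s : ℂˣ) (f : Smooth) : scaleS t s (conjS f) = conjS (scaleS t s f) := rfl

theorem scaleS_hat_lam (t s : ℂˣ) (k : Fin 2) :
    scaleS t s (hat lam k) = starRingEnd ℂ (t : ℂ) • hat lam k := by
  fin_cases k <;> simp [hat, scaleS_conjS, scaleS_lam, conjS_smul]

theorem scaleS_hat_mu (t s : ℂˣ) (k : Fin 2) :
    scaleS t s (hat mu k) = starRingEnd ℂ (s : ℂ) • hat mu k := by
  fin_cases k <;> simp [hat, scaleS_conjS, scaleS_mu, conjS_smul]

theorem scaleS_up (t s : ℂˣ) (f : Fin 2 → Smooth) (k : Fin 2) :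
    scaleS t s (up f k) = up (fun j => scaleS t s (f j)) k := by
  fin_cases k <;> simp [up]

theorem up_smul (c : ℂ) (f : Fin 2 → Smooth) (k : Fin 2) :
    up (fun j => c • f j) k = c • up f k := by
  fin_cases k <;> simp [up]

theorem scaleS_nrm_lam (t s : ℂˣ) :
    scaleS t s (nrm lam) = ((t : ℂ) * starRingEnd ℂ (t : ℂ)) • nrm lam := by
  simp only [nrm, map_sum, map_mul, scaleS_lam, scaleS_up, scaleS_hat_lam, up_smul, Finset.smul_sum,
    smul_mul_smul_comm]

theorem scaleS_nrm_mu (t s : ℂˣ) :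
    scaleS t s (nrm mu) = ((s : ℂ) * starRingEnd ℂ (s : ℂ)) • nrm mu := by
  simp only [nrm, map_sum, map_mul, scaleS_mu, scaleS_up, scaleS_hat_mu, up_smul, Finset.smul_sum,
    smul_mul_smul_comm]

theorem inv_unique {f g h : Smooth} (h₁ : f * g = 1) (h₂ : f * h = 1) : g = h :=
  left_inv_eq_right_inv ((mul_comm g f).trans h₁) h₂

theorem conj_unit_ne (t : ℂˣ) : starRingEnd ℂ (t : ℂ) ≠ 0 := by simp

theorem scaleS_invLam (t s : ℂˣ) :
    scaleS t s invLam = ((t : ℂ) * starRingEnd ℂ (t : ℂ))⁻¹ • invLam := by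
  refine inv_unique (f := scaleS t s (nrm lam)) ?_ ?_
  · rw [← map_mul, invLam_mul, map_one]
  · rw [scaleS_nrm_lam, smul_mul_smul_comm, invLam_mul,
      mul_inv_cancel₀ (mul_ne_zero t.ne_zero (conj_unit_ne t)), one_smul]

theorem scaleS_invMu (t s : ℂˣ) :
    scaleS t s invMu = ((s : ℂ) * starRingEnd ℂ (s : ℂ))⁻¹ • invMu := by
  refine inv_unique (f := scaleS t s (nrm mu)) ?_ ?_
  · rw [← map_mul, invMu_mul, map_one]
  · rw [scaleS_nrm_mu, smul_mul_smul_comm, invMu_mul,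
      mul_inv_cancel₀ (mul_ne_zero s.ne_zero (conj_unit_ne s)), one_smul]

theorem scaleS_dX (t s : ℂˣ) (a b : Fin 2) (f : Smooth) :
    scaleS t s (dX a b f) = dX a b (scaleS t s f) := by
  have h : ∀ k, scaleL t s (exX k) = exX k := fun k => by simp [scaleL_apply, exX]
  fin_cases a <;> fin_cases b <;> simp [dX, wirt_scaleS, wirtBar_scaleS, h]

theorem scaleS_dLamHat (t s : ℂˣ) (b : Fin 2) (f : Smooth) :
    dLamHat b (scaleS t s f) = starRingEnd ℂ (t : ℂ) • scaleS t s (dLamHat b f) := by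
  have h : ∀ k, scaleL t s (exL k) = (t : ℂ) • exL k := fun k => by simp [scaleL_apply, exL]
  fin_cases b <;> simp [dLamHat, wirtBar_scaleS, h, wirtBar_csmul]

theorem scaleS_dMuHat (t s : ℂˣ) (b : Fin 2) (f : Smooth) :
    dMuHat b (scaleS t s f) = starRingEnd ℂ (s : ℂ) • scaleS t s (dMuHat b f) := by
  have h : ∀ k, scaleL t s (exM k) = (s : ℂ) • exM k := fun k => by simp [scaleL_apply, exM]
  fin_cases b <;> simp [dMuHat, wirtBar_scaleS, h, wirtBar_csmul]

theorem scaleS_transl (t s : ℂˣ) (c : Fin 2 → Fin 2 → Smooth) (f : Smooth) :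
    scaleS t s (transl c f) = transl (fun a b => scaleS t s (c a b)) (scaleS t s f) := by
  simp only [transl_apply, map_sum, map_mul, scaleS_dX]

theorem transl_smul (r : ℂ) (c : Fin 2 → Fin 2 → Smooth) (f : Smooth) :
    transl (fun a b => r • c a b) f = r • transl c f := by
  simp only [transl_apply, Finset.smul_sum, smul_mul_assoc]

theorem scaleS_hEF (t s : ℂˣ) (f : Smooth) :
    scaleS t s (hEF f) = ((t : ℂ) * s) • hEF (scaleS t s f) := by
  rw [hEF_eq, scaleS_transl, ← transl_smul]
  simp only [map_mul, scaleS_up, scaleS_lam, scaleS_mu, up_smul, smul_mul_smul_comm, mul_comm]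

theorem scaleS_eW (t s : ℂˣ) (f : Smooth) :
    scaleS t s (eW f) = ((t : ℂ)⁻¹ * s) • eW (scaleS t s f) := by
  rw [eW_eq, scaleS_transl, ← transl_smul]
  have h : (s : ℂ) * starRingEnd ℂ (t : ℂ) * ((t : ℂ) * starRingEnd ℂ (t : ℂ))⁻¹ = (t : ℂ)⁻¹ * s := by
    have := conj_unit_ne t
    field_simp
  simp only [map_mul, scaleS_up, scaleS_hat_lam, scaleS_mu, scaleS_invLam, up_smul,
    smul_mul_smul_comm, h]

theorem scaleS_eWhat (t s : ℂˣ) (f : Smooth) :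
    scaleS t s (eWhat f) = ((t : ℂ) * (s : ℂ)⁻¹) • eWhat (scaleS t s f) := by
  rw [eWhat_eq, scaleS_transl, ← transl_smul]
  have h : starRingEnd ℂ (s : ℂ) * (t : ℂ) * ((s : ℂ) * starRingEnd ℂ (s : ℂ))⁻¹ = (t : ℂ) * (s : ℂ)⁻¹ := by
    have := conj_unit_ne s
    field_simp
  simp only [map_neg, map_mul, scaleS_up, scaleS_hat_mu, scaleS_lam, scaleS_invMu, up_smul,
    smul_mul_smul_comm, h, smul_neg]

theorem scaleS_hEL (t s : ℂˣ) (f : Smooth) :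
    scaleS t s (hEL f) = ((t : ℂ) ^ 2) • hEL (scaleS t s f) := by
  simp only [hEL_apply, map_mul, map_sum, scaleS_nrm_lam, scaleS_lam, scaleS_dLamHat]
  simp only [mul_smul_comm, smul_mul_assoc, smul_smul, ← Finset.smul_sum]
  congr 1
  ring

theorem scaleS_hER (t s : ℂˣ) (f : Smooth) :
    scaleS t s (hER f) = ((s : ℂ) ^ 2) • hER (scaleS t s f) := by
  simp only [hER_apply, map_mul, map_sum, scaleS_nrm_mu, scaleS_mu, scaleS_dMuHat]
  simp only [mul_smul_comm, smul_mul_assoc, smul_smul, ← Finset.smul_sum]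
  congr 1
  ring

/-! ### Superforms on the cone

Fermionic coordinates occur only holomorphically, through `η^α_i` and `θ^{iα}`, so functions are
elements of the exterior algebra on these twelve coordinates over the smooth functions of the bosonic
coordinates.  Forms are polynomials in the basis one-forms with functions as coefficients. -/

/-- The anticommuting generators: the bosonic one-forms `v̂^F`, `v̂^L`, `v̂^R` and the fermionic
coordinates `η^a_i` (`eta a i`) and `θ^{ia}` (`theta i a`). -/
inductive OddGen
  | vF | vL | vR
  | eta (a : Fin 2) (i : Fin 3)
  | theta (i : Fin 3) (a : Fin 2)
  deriving DecidableEq, Fintype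

/-- The commuting generators: the fermionic one-forms `v̂_i` (`vEta i`, dual to
`V̂^i = lam^α ∂/∂η^α_i`) and `v̂^i` (`vTheta i`, dual to `V̂_i = mu^α ∂/∂θ^{iα}`). -/
inductive EvenGen
  | vEta (i : Fin 3)
  | vTheta (i : Fin 3)

/-- The free supercommutative algebra on the generators. -/
abbrev ConstForm : Type := ExteriorAlgebra ℂ (OddGen → ℂ) ⊗[ℂ] MvPolynomial EvenGen ℂ

instance : Ring ConstForm := Algebra.TensorProduct.instRing

namespace Raw

/-- Forms with smooth coefficients. -/
abbrev Form : Type := ConstForm ⊗[ℂ] Smooth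

instance : Ring Form := Algebra.TensorProduct.instRing
instance : Algebra ℂ Form := Algebra.TensorProduct.instAlgebra
instance : Distrib Form := inferInstance

/-- An anticommuting generator as a form. -/
def odd (k : OddGen) : Form := (ExteriorAlgebra.ι ℂ (Pi.single k 1) ⊗ₜ 1) ⊗ₜ 1

/-- A commuting generator as a form. -/
def evn (j : EvenGen) : Form := (1 ⊗ₜ MvPolynomial.X j) ⊗ₜ 1

/-- A smooth function of the bosonic coordinates as a form. -/
def fn (f : Smooth) : Form := 1 ⊗ₜ f

/-- The left derivative with respect to an anticommuting generator. -/
def dOdd (k : OddGen) : Form →ₗ[ℂ] Form :=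
  ((CliffordAlgebra.contractLeft (Q := (0 : QuadraticForm ℂ (OddGen → ℂ))) (LinearMap.proj k)).rTensor _).rTensor _

/-- A vector field in the bosonic directions, applied to the coefficient functions. -/
def dFn (D : Derivation ℂ Smooth Smooth) : Form →ₗ[ℂ] Form := (D : Smooth →ₗ[ℂ] Smooth).lTensor _

/-- The algebra map multiplying the generators by constants and acting by `φ` on the functions of the
bosonic coordinates. -/
def diag (c : OddGen → ℂ) (e : EvenGen → ℂ) (φ : Smooth →ₐ[ℂ] Smooth) : Form →ₐ[ℂ] Form :=
  Algebra.TensorProduct.map (Algebra.TensorProduct.map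
    (ExteriorAlgebra.map (LinearMap.pi fun k => c k • LinearMap.proj k))
    (MvPolynomial.aeval fun j => e j • MvPolynomial.X j)) φ

theorem diag_odd (c e φ) (k : OddGen) : diag c e φ (odd k) = c k • odd k := by
  have : (LinearMap.pi fun k => c k • LinearMap.proj k : (OddGen → ℂ) →ₗ[ℂ] (OddGen → ℂ)) (Pi.single k 1)
      = c k • Pi.single k 1 := by
    ext j
    by_cases h : j = k
    · subst h; simp
    · simp [h]
  simp [diag, odd, this, TensorProduct.smul_tmul']

theorem diag_evn (c e φ) (k : EvenGen) : diag c e φ (evn k) = e k • evn k := by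
  simp only [diag, evn, Algebra.TensorProduct.map_tmul, map_one, MvPolynomial.aeval_X]
  rw [TensorProduct.tmul_smul, ← TensorProduct.smul_tmul']

theorem diag_fn (c e φ) (f : Smooth) : diag c e φ (fn f) = fn (φ f) := by
  simp [diag, fn]

theorem smul_eq_fn_mul (c : ℂ) (a : Form) : c • a = fn (algebraMap ℂ Smooth c) * a := by
  induction a using TensorProduct.induction_on with
  | zero => simp
  | tmul p f =>
    rw [fn, Algebra.TensorProduct.tmul_mul_tmul, one_mul, ← TensorProduct.tmul_smul,
      Algebra.smul_def]
  | add x y hx hy => rw [smul_add, hx, hy, mul_add]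

theorem form_induction {C : Form → Prop} (hodd : ∀ k, C (odd k)) (hevn : ∀ j, C (evn j))
    (hfn : ∀ f, C (fn f)) (hmul : ∀ a b, C a → C b → C (a * b)) (hadd : ∀ a b, C a → C b → C (a + b))
    (a : Form) : C a := by
  have hsmul : ∀ (c : ℂ) a, C a → C (c • a) := fun c a ha => by
    rw [smul_eq_fn_mul]; exact hmul _ _ (hfn _) ha
  have h1 : C 1 := hfn 1
  have h0 : C 0 := by simpa using hsmul 0 _ h1
  have hsum : ∀ (s : Finset OddGen) (g : OddGen → Form), (∀ k, C (g k)) → C (∑ k ∈ s, g k) := by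
    intro s g hg
    induction s using Finset.induction_on with
    | empty => simpa using h0
    | insert k s hk ih => rw [Finset.sum_insert hk]; exact hadd _ _ (hg k) ih
  have hext : ∀ x : ExteriorAlgebra ℂ (OddGen → ℂ), C ((x ⊗ₜ 1) ⊗ₜ 1) := fun x => by
    induction x using ExteriorAlgebra.induction with
    | algebraMap r =>
      rw [Algebra.algebraMap_eq_smul_one, ← TensorProduct.smul_tmul', ← TensorProduct.smul_tmul']
      exact hsmul _ _ h1
    | ι v =>
      have : ((ExteriorAlgebra.ι ℂ v ⊗ₜ 1) ⊗ₜ 1 : Form) = ∑ k, v k • odd k := by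
        conv_lhs => rw [pi_eq_sum_univ' v]
        simp only [odd, map_sum, map_smul, TensorProduct.sum_tmul, TensorProduct.smul_tmul']
      rw [this]
      exact hsum _ _ fun k => hsmul _ _ (hodd k)
    | mul x y hx hy => simpa using hmul _ _ hx hy
    | add x y hx hy => rw [TensorProduct.add_tmul, TensorProduct.add_tmul]; exact hadd _ _ hx hy
  have hpol : ∀ y : MvPolynomial EvenGen ℂ, C ((1 ⊗ₜ y) ⊗ₜ 1) := fun y => by
    induction y using MvPolynomial.induction_on with
    | C r =>
      rw [← MvPolynomial.algebraMap_eq, Algebra.algebraMap_eq_smul_one, TensorProduct.tmul_smul,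
        ← TensorProduct.smul_tmul']
      exact hsmul _ _ h1
    | add x y hx hy => rw [TensorProduct.tmul_add, TensorProduct.add_tmul]; exact hadd _ _ hx hy
    | mul_X x j hx => simpa [evn] using hmul _ _ hx (hevn j)
  induction a using TensorProduct.induction_on with
  | zero => exact h0
  | tmul p f =>
    have : (p ⊗ₜ f : Form) = (p ⊗ₜ 1) * fn f := by simp [fn]
    rw [this]
    refine hmul _ _ ?_ (hfn f)
    induction p using TensorProduct.induction_on with
    | zero => rw [TensorProduct.zero_tmul]; exact h0
    | tmul x y => simpa using hmul _ _ (hext x) (hpol y)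
    | add x y hx hy => rw [TensorProduct.add_tmul]; exact hadd _ _ (hx (by simp [fn])) (hy (by simp [fn]))
  | add x y hx hy => exact hadd _ _ hx hy

theorem fn_mul (f g : Smooth) : fn (f * g) = fn f * fn g := by simp [fn]

theorem fn_add (f g : Smooth) : fn (f + g) = fn f + fn g := by simp [fn, TensorProduct.tmul_add]

theorem fn_one : fn 1 = 1 := rfl

theorem fn_zero : fn 0 = 0 := by simp [fn]

theorem fn_sub (f g : Smooth) : fn (f - g) = fn f - fn g := by simp [fn, TensorProduct.tmul_sub]

theorem fn_smul (c : ℂ) (f : Smooth) : fn (c • f) = c • fn f := by simp [fn, TensorProduct.tmul_smul]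

theorem fn_sum {ι : Type*} (s : Finset ι) (f : ι → Smooth) : fn (∑ i ∈ s, f i) = ∑ i ∈ s, fn (f i) := by
  simp [fn, TensorProduct.tmul_sum]

theorem fn_comm (f : Smooth) (a : Form) : fn f * a = a * fn f := by
  induction a using TensorProduct.induction_on with
  | zero => simp
  | tmul p g => simp [fn, mul_comm]
  | add x y hx hy => rw [mul_add, add_mul, hx, hy]

theorem evn_comm (j : EvenGen) (a : Form) : evn j * a = a * evn j := by
  induction a using TensorProduct.induction_on with
  | zero => simp
  | tmul p g =>
    have : ∀ p : ConstForm, ((1 : ExteriorAlgebra ℂ (OddGen → ℂ)) ⊗ₜ[ℂ] MvPolynomial.X j : ConstForm) * p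
        = p * (1 ⊗ₜ[ℂ] MvPolynomial.X j) := fun p => by
      induction p using TensorProduct.induction_on with
      | zero => simp
      | tmul x y => simp [mul_comm]
      | add x y hx hy => rw [mul_add, add_mul, hx, hy]
    simp [evn, this]
  | add x y hx hy => rw [mul_add, add_mul, hx, hy]

theorem odd_sq (k : OddGen) : odd k * odd k = 0 := by simp [odd]

theorem odd_anticomm (k l : OddGen) : odd k * odd l = -(odd l * odd k) := by
  have h := ExteriorAlgebra.ι_add_mul_swap (R := ℂ) (Pi.single k 1 : OddGen → ℂ) (Pi.single l 1)
  rw [eq_neg_iff_add_eq_zero]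
  simp only [odd, Algebra.TensorProduct.tmul_mul_tmul, ← TensorProduct.add_tmul, h, one_mul,
    TensorProduct.zero_tmul]

theorem dFn_mul (D : Derivation ℂ Smooth Smooth) (a b : Form) :
    dFn D (a * b) = dFn D a * b + a * dFn D b := by
  induction a using TensorProduct.induction_on with
  | zero => simp
  | add x y hx hy => simp only [add_mul, map_add, hx, hy]; abel
  | tmul p f =>
    induction b using TensorProduct.induction_on with
    | zero => simp
    | add x y hx hy => simp only [mul_add, map_add, hx, hy]; abel
    | tmul q g =>
      simp only [dFn, Algebra.TensorProduct.tmul_mul_tmul, LinearMap.lTensor_tmul,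
        Derivation.coeFn_coe, Derivation.leibniz, TensorProduct.tmul_add, smul_eq_mul]
      rw [add_comm, mul_comm g]

theorem dFn_fn (D) (f : Smooth) : dFn D (fn f) = fn (D f) := by simp [dFn, fn]

theorem dFn_odd (D) (k : OddGen) : dFn D (odd k) = 0 := by simp [dFn, odd]

theorem dFn_evn (D) (k : EvenGen) : dFn D (evn k) = 0 := by simp [dFn, evn]

theorem dOdd_fn (k) (f : Smooth) : dOdd k (fn f) = 0 := by
  simp [dOdd, fn, Algebra.TensorProduct.one_def, CliffordAlgebra.contractLeft_one]

theorem dOdd_evn (k) (j : EvenGen) : dOdd k (evn j) = 0 := by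
  simp [dOdd, evn, CliffordAlgebra.contractLeft_one]

theorem dOdd_odd (k l) : dOdd k (odd l) = if k = l then 1 else 0 := by
  have h : CliffordAlgebra.contractLeft (Q := (0 : QuadraticForm ℂ (OddGen → ℂ))) (LinearMap.proj k)
      (ExteriorAlgebra.ι ℂ (Pi.single l 1)) = if k = l then 1 else 0 := by
    refine (CliffordAlgebra.contractLeft_ι (Q := (0 : QuadraticForm ℂ (OddGen → ℂ))) _ _).trans ?_
    by_cases hkl : k = l
    · subst hkl; simp
    · simp [hkl]
  simp only [dOdd, odd, LinearMap.rTensor_tmul, h]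
  split_ifs
  · rfl
  · simp

theorem dOdd_odd_mul (k l) (b : Form) :
    dOdd k (odd l * b) = (if k = l then (1 : ℂ) else 0) • b - odd l * dOdd k b := by
  induction b using TensorProduct.induction_on with
  | zero => simp
  | add x y hx hy => simp only [mul_add, map_add, hx, hy, smul_add]; abel
  | tmul p f =>
    induction p using TensorProduct.induction_on with
    | zero => simp
    | add x y hx hy => simp only [mul_add, map_add, TensorProduct.add_tmul, hx, hy, smul_add]; abel
    | tmul x y =>
      have h : CliffordAlgebra.contractLeft (Q := (0 : QuadraticForm ℂ (OddGen → ℂ))) (LinearMap.proj k)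
          (ExteriorAlgebra.ι ℂ (Pi.single l 1) * x) = (if k = l then (1 : ℂ) else 0) • x
            - ExteriorAlgebra.ι ℂ (Pi.single l 1) *
              CliffordAlgebra.contractLeft (Q := (0 : QuadraticForm ℂ (OddGen → ℂ))) (LinearMap.proj k) x := by
        refine (CliffordAlgebra.contractLeft_ι_mul _ _ _).trans ?_
        by_cases hkl : k = l
        · subst hkl; simp
        · simp [hkl]
      simp only [dOdd, odd, Algebra.TensorProduct.tmul_mul_tmul, LinearMap.rTensor_tmul, one_mul, h,
        TensorProduct.sub_tmul, TensorProduct.smul_tmul']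

theorem dOdd_fn_mul (k) (f : Smooth) (b : Form) : dOdd k (fn f * b) = fn f * dOdd k b := by
  induction b using TensorProduct.induction_on with
  | zero => simp
  | add x y hx hy => simp only [mul_add, map_add, hx, hy]
  | tmul p g => simp [dOdd, fn]

theorem dOdd_evn_mul (k) (j : EvenGen) (b : Form) : dOdd k (evn j * b) = evn j * dOdd k b := by
  induction b using TensorProduct.induction_on with
  | zero => simp
  | add x y hx hy => simp only [mul_add, map_add, hx, hy]
  | tmul p f =>
    induction p using TensorProduct.induction_on with
    | zero => simp
    | add x y hx hy => simp only [mul_add, map_add, TensorProduct.add_tmul, hx, hy]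
    | tmul x y => simp [dOdd, evn]

end Raw

/-- The algebra `Raw.Form`, with its instances sealed to keep instance search fast. -/
def Form : Type := Raw.Form

instance : Ring Form := inferInstanceAs (Ring Raw.Form)

instance : Algebra ℂ Form := inferInstanceAs (Algebra ℂ Raw.Form)

/-- An anticommuting generator as a form. -/
def odd : OddGen → Form := Raw.odd

/-- A commuting generator as a form. -/
def evn : EvenGen → Form := Raw.evn

/-- A smooth function of the bosonic coordinates as a form. -/
def fn : Smooth → Form := Raw.fn

/-- The left derivative with respect to an anticommuting generator. -/
def dOdd : OddGen → Form →ₗ[ℂ] Form := Raw.dOdd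

/-- A vector field in the bosonic directions, applied to the coefficient functions. -/
def dFn : Derivation ℂ Smooth Smooth → Form →ₗ[ℂ] Form := Raw.dFn

/-- The algebra map multiplying the generators by constants and acting on the functions of the
bosonic coordinates by a given algebra map. -/
def diag : (OddGen → ℂ) → (EvenGen → ℂ) → (Smooth →ₐ[ℂ] Smooth) → Form →ₐ[ℂ] Form := Raw.diag


theorem diag_odd (c e φ) (k : OddGen) : diag c e φ (odd k) = c k • odd k :=
  Raw.diag_odd c e φ k

theorem diag_evn (c e φ) (k : EvenGen) : diag c e φ (evn k) = e k • evn k :=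
  Raw.diag_evn c e φ k

theorem diag_fn (c e φ) (f : Smooth) : diag c e φ (fn f) = fn (φ f) :=
  Raw.diag_fn c e φ f

theorem smul_eq_fn_mul (c : ℂ) (a : Form) : c • a = fn (algebraMap ℂ Smooth c) * a :=
  Raw.smul_eq_fn_mul c a

theorem form_induction {C : Form → Prop} (hodd : ∀ k, C (odd k)) (hevn : ∀ j, C (evn j))
    (hfn : ∀ f, C (fn f)) (hmul : ∀ a b, C a → C b → C (a * b)) (hadd : ∀ a b, C a → C b → C (a + b))
    (a : Form) : C a :=
  Raw.form_induction hodd hevn hfn hmul hadd a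

theorem fn_mul (f g : Smooth) : fn (f * g) = fn f * fn g :=
  Raw.fn_mul f g

theorem fn_add (f g : Smooth) : fn (f + g) = fn f + fn g :=
  Raw.fn_add f g

theorem fn_one : fn 1 = 1 :=
  Raw.fn_one 

theorem fn_zero : fn 0 = 0 :=
  Raw.fn_zero 

theorem fn_sub (f g : Smooth) : fn (f - g) = fn f - fn g :=
  Raw.fn_sub f g

theorem fn_smul (c : ℂ) (f : Smooth) : fn (c • f) = c • fn f :=
  Raw.fn_smul c f

theorem fn_sum {ι : Type*} (s : Finset ι) (f : ι → Smooth) : fn (∑ i ∈ s, f i) = ∑ i ∈ s, fn (f i) :=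
  Raw.fn_sum s f

theorem fn_comm (f : Smooth) (a : Form) : fn f * a = a * fn f :=
  Raw.fn_comm f a

theorem evn_comm (j : EvenGen) (a : Form) : evn j * a = a * evn j :=
  Raw.evn_comm j a

theorem odd_sq (k : OddGen) : odd k * odd k = 0 :=
  Raw.odd_sq k

theorem odd_anticomm (k l : OddGen) : odd k * odd l = -(odd l * odd k) :=
  Raw.odd_anticomm k l

theorem dFn_mul (D : Derivation ℂ Smooth Smooth) (a b : Form) :
    dFn D (a * b) = dFn D a * b + a * dFn D b :=
  Raw.dFn_mul D a b

theorem dFn_fn (D) (f : Smooth) : dFn D (fn f) = fn (D f) :=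
  Raw.dFn_fn D f

theorem dFn_odd (D) (k : OddGen) : dFn D (odd k) = 0 :=
  Raw.dFn_odd D k

theorem dFn_evn (D) (k : EvenGen) : dFn D (evn k) = 0 :=
  Raw.dFn_evn D k

theorem dOdd_fn (k) (f : Smooth) : dOdd k (fn f) = 0 :=
  Raw.dOdd_fn k f

theorem dOdd_evn (k) (j : EvenGen) : dOdd k (evn j) = 0 :=
  Raw.dOdd_evn k j

theorem dOdd_odd (k l) : dOdd k (odd l) = if k = l then 1 else 0 :=
  Raw.dOdd_odd k l

theorem dOdd_odd_mul (k l) (b : Form) :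
    dOdd k (odd l * b) = (if k = l then (1 : ℂ) else 0) • b - odd l * dOdd k b :=
  Raw.dOdd_odd_mul k l b

theorem dOdd_fn_mul (k) (f : Smooth) (b : Form) : dOdd k (fn f * b) = fn f * dOdd k b :=
  Raw.dOdd_fn_mul k f b

theorem dOdd_evn_mul (k) (j : EvenGen) (b : Form) : dOdd k (evn j * b) = evn j * dOdd k b :=
  Raw.dOdd_evn_mul k j b

/-! ### The supercommutative structure -/

theorem diag_comp (c c' : OddGen → ℂ) (e e' : EvenGen → ℂ) (φ φ' : Smooth →ₐ[ℂ] Smooth) (a : Form) :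
    diag c e φ (diag c' e' φ' a) = diag (c * c') (e * e') (φ.comp φ') a := by
  induction a using form_induction with
  | hodd k => simp only [diag_odd, map_smul, smul_smul, Pi.mul_apply, mul_comm]
  | hevn k => simp only [diag_evn, map_smul, smul_smul, Pi.mul_apply, mul_comm]
  | hfn f => simp only [diag_fn, AlgHom.comp_apply]
  | hmul a b ha hb => simp only [map_mul, ha, hb]
  | hadd a b ha hb => simp only [map_add, ha, hb]

theorem diag_one (a : Form) : diag 1 1 (AlgHom.id ℂ Smooth) a = a := by
  induction a using form_induction with
  | hodd k => simp only [diag_odd, Pi.one_apply, one_smul]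
  | hevn k => simp only [diag_evn, Pi.one_apply, one_smul]
  | hfn f => simp only [diag_fn, AlgHom.id_apply]
  | hmul a b ha hb => simp only [map_mul, ha, hb]
  | hadd a b ha hb => simp only [map_add, ha, hb]

/-- The total parity automorphism (form degree plus fermion number). -/
def sig : Form →ₐ[ℂ] Form := diag (fun _ => -1) 1 (AlgHom.id ℂ Smooth)

theorem sig_odd (k : OddGen) : sig (odd k) = -odd k := by rw [sig, diag_odd, neg_smul, one_smul]

theorem sig_evn (j : EvenGen) : sig (evn j) = evn j := by rw [sig, diag_evn, Pi.one_apply, one_smul]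

theorem sig_fn (f : Smooth) : sig (fn f) = fn f := by rw [sig, diag_fn, AlgHom.id_apply]

theorem sig_sig (a : Form) : sig (sig a) = a := by
  conv_rhs => rw [← diag_one a]
  rw [sig, diag_comp]
  congr 2
  · ext; simp
  · exact one_mul _

theorem sig_diag (c e φ) (a : Form) : sig (diag c e φ a) = diag c e φ (sig a) := by
  rw [sig, diag_comp, diag_comp, mul_comm, mul_comm e]
  rfl

theorem odd_mul (k : OddGen) (a : Form) : odd k * a = sig a * odd k := by
  induction a using form_induction with
  | hodd l => rw [sig_odd, neg_mul, odd_anticomm]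
  | hevn l => rw [sig_evn, evn_comm]
  | hfn f => rw [sig_fn, fn_comm]
  | hmul a b ha hb => rw [map_mul, ← mul_assoc, ha, mul_assoc, hb, mul_assoc]
  | hadd a b ha hb => rw [map_add, mul_add, add_mul, ha, hb]

theorem mul_even_odd (a : Form) :
    (∀ b, sig b = b → a * b = b * a) ∧ (∀ b, sig b = -b → a * b = b * sig a) := by
  induction a using form_induction with
  | hodd k =>
    refine ⟨fun b hb => ?_, fun b hb => ?_⟩
    · rw [odd_mul, hb]
    · rw [odd_mul, hb, sig_odd, neg_mul, mul_neg]
  | hevn k => exact ⟨fun b _ => evn_comm _ _, fun b _ => by rw [sig_evn, evn_comm]⟩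
  | hfn k => exact ⟨fun b _ => fn_comm _ _, fun b _ => by rw [sig_fn, fn_comm]⟩
  | hmul x y hx hy =>
    refine ⟨fun b hb => ?_, fun b hb => ?_⟩
    · rw [mul_assoc, hy.1 b hb, ← mul_assoc, hx.1 b hb, mul_assoc]
    · rw [mul_assoc, hy.2 b hb, ← mul_assoc, hx.2 b hb, mul_assoc, map_mul]
  | hadd x y hx hy =>
    refine ⟨fun b hb => ?_, fun b hb => ?_⟩
    · rw [add_mul, mul_add, hx.1 b hb, hy.1 b hb]
    · rw [add_mul, map_add, mul_add, hx.2 b hb, hy.2 b hb]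

/-! ### Derivations -/

/-- Odd derivations with respect to the total parity. -/
def IsOddDer (D : Form →ₗ[ℂ] Form) : Prop := ∀ a b, D (a * b) = D a * b + sig a * D b

/-- Even derivations with respect to the total parity. -/
def IsEvenDer (D : Form →ₗ[ℂ] Form) : Prop := ∀ a b, D (a * b) = D a * b + a * D b

theorem IsOddDer.add {D E : Form →ₗ[ℂ] Form} (hD : IsOddDer D) (hE : IsOddDer E) : IsOddDer (D + E) :=
  fun a b => by
    simp only [LinearMap.add_apply, hD a b, hE a b, mul_add, add_mul]; abel

theorem IsOddDer.sum {ι : Type*} (s : Finset ι) {D : ι → Form →ₗ[ℂ] Form} (h : ∀ i, IsOddDer (D i)) :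
    IsOddDer (∑ i ∈ s, D i) := fun a b => by
  simp only [LinearMap.sum_apply, fun i => h i a b, Finset.sum_add_distrib, Finset.mul_sum,
    Finset.sum_mul]

theorem IsEvenDer.add {D E : Form →ₗ[ℂ] Form} (hD : IsEvenDer D) (hE : IsEvenDer E) :
    IsEvenDer (D + E) := fun a b => by
  simp only [LinearMap.add_apply, hD a b, hE a b, mul_add, add_mul]; abel

/-- Left multiplication composed with an operator. -/
def lmul (x : Form) (D : Form →ₗ[ℂ] Form) : Form →ₗ[ℂ] Form := LinearMap.mulLeft ℂ x ∘ₗ D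

theorem lmul_apply (x : Form) (D : Form →ₗ[ℂ] Form) (a : Form) : lmul x D a = x * D a := rfl

theorem IsEvenDer.lmul_odd {D : Form →ₗ[ℂ] Form} (hD : IsEvenDer D) {x : Form}
    (hx : ∀ a, x * a = sig a * x) : IsOddDer (lmul x D) := fun a b => by
  rw [lmul_apply, lmul_apply, lmul_apply, hD, mul_add, ← mul_assoc, ← mul_assoc, hx a, mul_assoc]
  simp only [mul_assoc]

theorem IsEvenDer.lmul_even {D : Form →ₗ[ℂ] Form} (hD : IsEvenDer D) {x : Form}
    (hx : ∀ a, x * a = a * x) : IsEvenDer (lmul x D) := fun a b => by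
  rw [lmul_apply, lmul_apply, lmul_apply, hD, mul_add, ← mul_assoc, ← mul_assoc, hx a]
  simp only [mul_assoc]

theorem IsOddDer.lmul_even {D : Form →ₗ[ℂ] Form} (hD : IsOddDer D) {x : Form}
    (hx : ∀ a, x * a = a * x) : IsOddDer (lmul x D) := fun a b => by
  rw [lmul_apply, lmul_apply, lmul_apply, hD, mul_add, ← mul_assoc, ← mul_assoc, hx (sig a)]
  simp only [mul_assoc]

theorem dFn_isEvenDer (D) : IsEvenDer (dFn D) := dFn_mul D

theorem dOdd_isOddDer (k) : IsOddDer (dOdd k) := fun a => by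
  induction a using form_induction with
  | hodd l =>
    intro b
    rw [dOdd_odd_mul, dOdd_odd, sig_odd]
    split_ifs <;> simp [sub_eq_add_neg]
  | hevn j => intro b; rw [dOdd_evn_mul, dOdd_evn, sig_evn, zero_mul, zero_add]
  | hfn f => intro b; rw [dOdd_fn_mul, dOdd_fn, sig_fn, zero_mul, zero_add]
  | hmul x y hx hy =>
    intro b
    rw [mul_assoc, hx, hy, hx, map_mul, mul_add, add_mul]
    simp only [mul_assoc, add_assoc]
  | hadd x y hx hy => intro b; simp only [add_mul, map_add, hx, hy]; abel

theorem IsOddDer.one {D : Form →ₗ[ℂ] Form} (hD : IsOddDer D) : D 1 = 0 := by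
  have := hD 1 1
  simpa using this

/-- An odd derivation is compatible with a diagonal automorphism if this holds on generators. -/
theorem IsOddDer.diag {D : Form →ₗ[ℂ] Form} (hD : IsOddDer D) (r : ℂ) (c e φ)
    (hodd : ∀ k, diag c e φ (D (odd k)) = r • D (diag c e φ (odd k)))
    (hevn : ∀ k, diag c e φ (D (evn k)) = r • D (diag c e φ (evn k)))
    (hfn : ∀ k, diag c e φ (D (fn k)) = r • D (diag c e φ (fn k))) (a : Form) :
    diag c e φ (D a) = r • D (diag c e φ a) := by
  induction a using form_induction with
  | hodd l => exact hodd l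
  | hevn j => exact hevn j
  | hfn f => exact hfn f
  | hmul x y hx hy =>
    rw [hD, map_add, map_mul, map_mul, map_mul, hD, hx, hy, smul_add, smul_mul_assoc, mul_smul_comm,
      sig_diag]
  | hadd x y hx hy => simp only [map_add, hx, hy, smul_add]

theorem IsOddDer.sq {D : Form →ₗ[ℂ] Form} (hD : IsOddDer D) (hs : ∀ a, sig (D a) = -D (sig a))
    (hodd : ∀ k, D (D (odd k)) = 0) (hevn : ∀ k, D (D (evn k)) = 0) (hfn : ∀ k, D (D (fn k)) = 0)
    (a : Form) : D (D a) = 0 := by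
  induction a using form_induction with
  | hodd l => exact hodd l
  | hevn j => exact hevn j
  | hfn f => exact hfn f
  | hmul x y hx hy =>
    rw [hD, map_add, hD, hD, hx, hy, hs]
    simp
  | hadd x y hx hy => rw [map_add, map_add, hx, hy, add_zero]

/-! ### The differentials -/

/-- The fermionic coordinate `η_i = η^α_i lam_α`. -/
def etaLow (i : Fin 3) : Form := ∑ a, odd (.eta a i) * fn (lam a)

/-- The fermionic coordinate `θ^i = θ^{iα} mu_α`. -/
def thetaUp (i : Fin 3) : Form := ∑ a, odd (.theta i a) * fn (mu a)

/-- The nilpotent even function `θ^i η_i`. -/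
def thetaEta : Form := ∑ i, thetaUp i * etaLow i

/-- The action of `V̂_L = Ê_L + θ^i η_i E_Ŵ` on coefficient functions. -/
def vecL : Form →ₗ[ℂ] Form := dFn hEL + lmul thetaEta (dFn eWhat)

/-- The action of `V̂_R = Ê_R + θ^i η_i E_W` on coefficient functions. -/
def vecR : Form →ₗ[ℂ] Form := dFn hER + lmul thetaEta (dFn eW)

/-- The operator `V̂^i = lam^α ∂/∂η^α_i`. -/
def vecEta (i : Fin 3) : Form →ₗ[ℂ] Form := ∑ a, lmul (fn (up lam a)) (dOdd (.eta a i))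

/-- The operator `V̂_i = mu^α ∂/∂θ^{iα}`. -/
def vecTheta (i : Fin 3) : Form →ₗ[ℂ] Form := ∑ a, lmul (fn (up mu a)) (dOdd (.theta i a))

/-- The differential `v̂^F V̂_F + v̂^L V̂_L + v̂^R V̂_R`; the last summand is the action on the basis
one-forms, `d v̂^F = - 2 v̂^L v̂^R θ^i η_i`, which is dual to `[V̂_L, V̂_R] = 2 θ^i η_i V̂_F`. -/
def dRed : Form →ₗ[ℂ] Form :=
  lmul (odd .vF) (dFn hEF) + lmul (odd .vL) vecL + lmul (odd .vR) vecR
    + lmul (-(2 : ℂ) • (odd .vL * odd .vR * thetaEta)) (dOdd .vF)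

/-- The fermionic part `v̂_i V̂^i + v̂^i V̂_i` of the differential. -/
def dFerm : Form →ₗ[ℂ] Form :=
  ∑ i, (lmul (evn (.vEta i)) (vecEta i) + lmul (evn (.vTheta i)) (vecTheta i))

/-- The differential `v̂^F V̂_F + v̂^L V̂_L + v̂^R V̂_R + v̂_i V̂^i + v̂^i V̂_i`. -/
def dTw : Form →ₗ[ℂ] Form := dRed + dFerm

theorem central_mul {x y : Form} (hx : ∀ a, x * a = a * x) (hy : ∀ a, y * a = a * y) (a : Form) :
    x * y * a = a * (x * y) := by
  rw [mul_assoc, hy, ← mul_assoc, hx, mul_assoc]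

theorem odd_mul_odd {x y : Form} (hx : ∀ a, x * a = sig a * x) (hy : ∀ a, y * a = sig a * y)
    (a : Form) : x * y * a = a * (x * y) := by
  rw [mul_assoc, hy, ← mul_assoc, hx, sig_sig, mul_assoc]

theorem odd_mul_fn (k : OddGen) (f : Smooth) (a : Form) :
    odd k * fn f * a = sig a * (odd k * fn f) := by
  rw [mul_assoc, fn_comm, ← mul_assoc, odd_mul, mul_assoc]

theorem sum_odd_mul {ι : Type*} (s : Finset ι) {x : ι → Form} (hx : ∀ i a, x i * a = sig a * x i)
    (a : Form) : (∑ i ∈ s, x i) * a = sig a * ∑ i ∈ s, x i := by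
  simp only [Finset.sum_mul, Finset.mul_sum, hx]

theorem etaLow_mul (i : Fin 3) (a : Form) : etaLow i * a = sig a * etaLow i :=
  sum_odd_mul _ (fun _ => odd_mul_fn _ _) a

theorem thetaUp_mul (i : Fin 3) (a : Form) : thetaUp i * a = sig a * thetaUp i :=
  sum_odd_mul _ (fun _ => odd_mul_fn _ _) a

theorem sig_etaLow (i : Fin 3) : sig (etaLow i) = -etaLow i := by
  simp only [etaLow, map_sum, map_mul, sig_odd, sig_fn, neg_mul, Finset.sum_neg_distrib]

theorem sig_thetaUp (i : Fin 3) : sig (thetaUp i) = -thetaUp i := by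
  simp only [thetaUp, map_sum, map_mul, sig_odd, sig_fn, neg_mul, Finset.sum_neg_distrib]

theorem sig_thetaEta : sig thetaEta = thetaEta := by
  simp only [thetaEta, map_sum, map_mul, sig_etaLow, sig_thetaUp, neg_mul_neg]

theorem thetaEta_comm (a : Form) : thetaEta * a = a * thetaEta := by
  simp only [thetaEta, Finset.sum_mul, Finset.mul_sum]
  exact Finset.sum_congr rfl fun i _ => odd_mul_odd (thetaUp_mul i) (etaLow_mul i) a

theorem vecL_isEvenDer : IsEvenDer vecL :=
  (dFn_isEvenDer _).add ((dFn_isEvenDer _).lmul_even thetaEta_comm)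

theorem vecR_isEvenDer : IsEvenDer vecR :=
  (dFn_isEvenDer _).add ((dFn_isEvenDer _).lmul_even thetaEta_comm)

theorem dRed_isOddDer : IsOddDer dRed := by
  refine (((dFn_isEvenDer _).lmul_odd (odd_mul _)).add (vecL_isEvenDer.lmul_odd (odd_mul _))).add
    (vecR_isEvenDer.lmul_odd (odd_mul _)) |>.add ((dOdd_isOddDer _).lmul_even fun a => ?_)
  rw [smul_mul_assoc, mul_smul_comm,
    central_mul (odd_mul_odd (odd_mul _) (odd_mul _)) thetaEta_comm]

theorem vecEta_isOddDer (i) : IsOddDer (vecEta i) :=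
  .sum _ fun _ => (dOdd_isOddDer _).lmul_even (fn_comm _)

theorem vecTheta_isOddDer (i) : IsOddDer (vecTheta i) :=
  .sum _ fun _ => (dOdd_isOddDer _).lmul_even (fn_comm _)

theorem dFerm_isOddDer : IsOddDer dFerm :=
  .sum _ fun i => ((vecEta_isOddDer i).lmul_even (evn_comm _)).add
    ((vecTheta_isOddDer i).lmul_even (evn_comm _))

theorem dTw_isOddDer : IsOddDer dTw := dRed_isOddDer.add dFerm_isOddDer

/-! Values on generators. -/

theorem vecL_fn (f : Smooth) : vecL (fn f) = fn (hEL f) + thetaEta * fn (eWhat f) := by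
  simp only [vecL, LinearMap.add_apply, lmul_apply, dFn_fn]

theorem vecR_fn (f : Smooth) : vecR (fn f) = fn (hER f) + thetaEta * fn (eW f) := by
  simp only [vecR, LinearMap.add_apply, lmul_apply, dFn_fn]

theorem vecL_odd (k) : vecL (odd k) = 0 := by
  simp only [vecL, LinearMap.add_apply, lmul_apply, dFn_odd, mul_zero, add_zero]

theorem vecR_odd (k) : vecR (odd k) = 0 := by
  simp only [vecR, LinearMap.add_apply, lmul_apply, dFn_odd, mul_zero, add_zero]

theorem vecL_evn (k) : vecL (evn k) = 0 := by
  simp only [vecL, LinearMap.add_apply, lmul_apply, dFn_evn, mul_zero, add_zero]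

theorem vecR_evn (k) : vecR (evn k) = 0 := by
  simp only [vecR, LinearMap.add_apply, lmul_apply, dFn_evn, mul_zero, add_zero]

theorem dRed_fn (f : Smooth) : dRed (fn f) =
    odd .vF * fn (hEF f) + odd .vL * (fn (hEL f) + thetaEta * fn (eWhat f))
      + odd .vR * (fn (hER f) + thetaEta * fn (eW f)) := by
  simp only [dRed, LinearMap.add_apply, lmul_apply, dFn_fn, vecL_fn, vecR_fn, dOdd_fn, mul_zero,
    add_zero]

theorem dRed_odd (k) : dRed (odd k) =
    if k = .vF then -(2 : ℂ) • (odd .vL * odd .vR * thetaEta) else 0 := by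
  simp only [dRed, LinearMap.add_apply, lmul_apply, dFn_odd, vecL_odd, vecR_odd, dOdd_odd, mul_zero,
    zero_add, mul_ite, mul_one, eq_comm]

theorem dRed_evn (k) : dRed (evn k) = 0 := by
  simp only [dRed, LinearMap.add_apply, lmul_apply, dFn_evn, vecL_evn, vecR_evn, dOdd_evn, mul_zero,
    add_zero]

theorem dFerm_fn (f : Smooth) : dFerm (fn f) = 0 := by
  simp only [dFerm, vecEta, vecTheta, LinearMap.sum_apply, LinearMap.add_apply, lmul_apply, dOdd_fn,
    mul_zero, Finset.sum_const_zero, add_zero]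

theorem dFerm_evn (k) : dFerm (evn k) = 0 := by
  simp only [dFerm, vecEta, vecTheta, LinearMap.sum_apply, LinearMap.add_apply, lmul_apply, dOdd_evn,
    mul_zero, Finset.sum_const_zero, add_zero]

theorem dFerm_vF : dFerm (odd .vF) = 0 := by
  simp [dFerm, vecEta, vecTheta, lmul_apply, dOdd_odd]

theorem dFerm_vL : dFerm (odd .vL) = 0 := by
  simp [dFerm, vecEta, vecTheta, lmul_apply, dOdd_odd]

theorem dFerm_vR : dFerm (odd .vR) = 0 := by
  simp [dFerm, vecEta, vecTheta, lmul_apply, dOdd_odd]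

theorem dFerm_eta (a i) : dFerm (odd (.eta a i)) = evn (.vEta i) * fn (up lam a) := by
  simp only [dFerm, vecEta, vecTheta, LinearMap.sum_apply, LinearMap.add_apply, lmul_apply, dOdd_odd,
    OddGen.eta.injEq, reduceCtorEq, if_false, mul_zero, Finset.sum_const_zero, add_zero, mul_ite,
    mul_one, ite_and]
  rw [Finset.sum_eq_single i]
  · rw [Finset.sum_eq_single a] <;> simp +contextual
  · intro j _ hj; simp [hj]
  · simp

theorem dFerm_theta (i a) : dFerm (odd (.theta i a)) = evn (.vTheta i) * fn (up mu a) := by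
  simp only [dFerm, vecEta, vecTheta, LinearMap.sum_apply, LinearMap.add_apply, lmul_apply, dOdd_odd,
    OddGen.theta.injEq, reduceCtorEq, if_false, mul_zero, Finset.sum_const_zero, zero_add, mul_ite,
    mul_one, ite_and]
  rw [Finset.sum_eq_single i]
  · rw [Finset.sum_eq_single a] <;> simp +contextual
  · intro j _ hj; simp [hj]
  · simp

theorem dRed_lam (a) : dRed (fn (lam a)) = 0 := by
  simp only [dRed_fn, hEF_lam, hEL_lam, hER_lam, eW_lam, eWhat_lam, fn_zero, mul_zero, add_zero]

theorem dRed_mu (a) : dRed (fn (mu a)) = 0 := by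
  simp only [dRed_fn, hEF_mu, hEL_mu, hER_mu, eW_mu, eWhat_mu, fn_zero, mul_zero, add_zero]

theorem up_self (s : Fin 2 → Smooth) : ∑ a, up s a * s a = 0 := by
  simp only [Fin.sum_univ_two, up_zero, up_one]; ring

theorem dFerm_etaLow (i) : dFerm (etaLow i) = 0 := by
  simp only [etaLow, map_sum, dFerm_isOddDer _ _, dFerm_eta, dFerm_fn, mul_zero, add_zero, mul_assoc,
    ← fn_mul]
  rw [← Finset.mul_sum, ← fn_sum, up_self, fn_zero, mul_zero]

theorem dFerm_thetaUp (i) : dFerm (thetaUp i) = 0 := by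
  simp only [thetaUp, map_sum, dFerm_isOddDer _ _, dFerm_theta, dFerm_fn, mul_zero, add_zero, mul_assoc,
    ← fn_mul]
  rw [← Finset.mul_sum, ← fn_sum, up_self, fn_zero, mul_zero]

theorem dRed_etaLow (i) : dRed (etaLow i) = 0 := by
  simp [etaLow, dRed_isOddDer _ _, dRed_odd, dRed_lam]

theorem dRed_thetaUp (i) : dRed (thetaUp i) = 0 := by
  simp [thetaUp, dRed_isOddDer _ _, dRed_odd, dRed_mu]

theorem dRed_thetaEta : dRed thetaEta = 0 := by
  simp [thetaEta, dRed_isOddDer _ _, dRed_etaLow, dRed_thetaUp]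

theorem dFerm_thetaEta : dFerm thetaEta = 0 := by
  simp [thetaEta, dFerm_isOddDer _ _, dFerm_etaLow, dFerm_thetaUp]

theorem dTw_fn (f : Smooth) : dTw (fn f) = dRed (fn f) := by
  rw [dTw, LinearMap.add_apply, dFerm_fn, add_zero]

theorem dTw_evn (k) : dTw (evn k) = 0 := by
  rw [dTw, LinearMap.add_apply, dFerm_evn, dRed_evn, add_zero]

/-- The part of `d ∘ d = 0` common to the two differentials. -/
theorem sq_aux {D : Form →ₗ[ℂ] Form} (hD : IsOddDer D)
    (hF : D (odd .vF) = -(2 : ℂ) • (odd .vL * odd .vR * thetaEta))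
    (hL : D (odd .vL) = 0) (hR : D (odd .vR) = 0) (hT : D thetaEta = 0)
    (hfn : ∀ f, D (fn f) = dRed (fn f)) :
    D (D (odd .vF)) = 0 ∧ ∀ f, D (D (fn f)) = 0 := by
  refine ⟨?_, fun f => ?_⟩
  · rw [hF, map_smul, hD, hD, hL, hR, hT]; simp
  · have e : ∀ k (x : Form), D (odd k * x) = D (odd k) * x - odd k * D x := fun k x => by
      rw [hD, sig_odd, neg_mul, sub_eq_add_neg]
    have eT : ∀ x : Form, D (thetaEta * x) = thetaEta * D x := fun x => by
      rw [hD, hT, sig_thetaEta, zero_mul, zero_add]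
    have tk : ∀ k x, thetaEta * (odd k * x) = odd k * (thetaEta * x) := fun k x => by
      rw [← mul_assoc, thetaEta_comm, mul_assoc]
    have kk : ∀ k x, odd k * (odd k * x) = 0 := fun k x => by rw [← mul_assoc, odd_sq, zero_mul]
    have kl : ∀ k l x, odd k * (odd l * x) = -(odd l * (odd k * x)) := fun k l x => by
      rw [← mul_assoc, odd_anticomm, neg_mul, mul_assoc]
    rw [hfn, dRed_fn]
    simp only [map_add, e, eT, hF, hL, hR, hfn, dRed_fn, hEL_hEF, hER_hEF, hEL_eW, hER_eWhat, eW_eWhat,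
      eW_hEF, eWhat_hEF, comm_hEL_hER _, fn_add, fn_sub, mul_add, mul_sub, tk, kk, zero_mul, zero_add,
      add_zero, mul_assoc, smul_mul_assoc, zero_sub, neg_add]
    rw [kl .vL .vF, kl .vL .vF, kl .vR .vF, kl .vR .vF]
    simp only [kl .vR .vL]
    module

theorem diag_thetaEta {c e φ} {x y b : ℂ} (hx : ∀ a i, c (.eta a i) = x) (hy : ∀ i a, c (.theta i a) = x)
    {wl wm : ℂ} (hl : ∀ k, φ (lam k) = wl • lam k) (hm : ∀ k, φ (mu k) = wm • mu k)
    (hb : x * wl = y) (hb' : x * wm * y = b) :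
    (∀ i, diag c e φ (etaLow i) = y • etaLow i) ∧ (∀ i, diag c e φ (thetaUp i) = (x * wm) • thetaUp i) ∧
      diag c e φ thetaEta = b • thetaEta := by
  have h1 : ∀ i, diag c e φ (etaLow i) = y • etaLow i := fun i => by
    simp only [etaLow, map_sum, map_mul, diag_odd, diag_fn, hx, hl, fn_smul, smul_mul_assoc,
      mul_smul_comm, smul_smul, mul_comm wl, hb, Finset.smul_sum]
  have h2 : ∀ i, diag c e φ (thetaUp i) = (x * wm) • thetaUp i := fun i => by
    simp only [thetaUp, map_sum, map_mul, diag_odd, diag_fn, hy, hm, fn_smul, smul_mul_assoc,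
      mul_smul_comm, smul_smul, mul_comm wm, Finset.smul_sum]
  refine ⟨h1, h2, ?_⟩
  simp only [thetaEta, map_sum, map_mul, h1, h2, smul_mul_assoc, mul_smul_comm, smul_smul,
    Finset.smul_sum, mul_comm y, hb']

theorem dRed_diag {c e φ} {r b aF aL aR aW aWh : ℂ} (hF : ∀ f, φ (hEF f) = aF • hEF (φ f))
    (hL : ∀ f, φ (hEL f) = aL • hEL (φ f)) (hR : ∀ f, φ (hER f) = aR • hER (φ f))
    (hW : ∀ f, φ (eW f) = aW • eW (φ f)) (hWh : ∀ f, φ (eWhat f) = aWh • eWhat (φ f))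
    (hb : diag c e φ thetaEta = b • thetaEta)
    (h1 : c .vF * aF = r) (h2 : c .vL * aL = r) (h3 : c .vL * (b * aWh) = r) (h4 : c .vR * aR = r)
    (h5 : c .vR * (b * aW) = r) (h6 : c .vL * c .vR * b = r * c .vF) (a : Form) :
    diag c e φ (dRed a) = r • dRed (diag c e φ a) := by
  refine dRed_isOddDer.diag _ _ _ _ (fun k => ?_) (fun k => ?_) (fun f => ?_) a
  · rw [diag_odd, map_smul, dRed_odd]
    split_ifs with h
    · subst h
      rw [map_smul, map_mul, map_mul, diag_odd, diag_odd, hb, smul_mul_smul_comm, smul_mul_smul_comm, h6]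
      module
    · simp
  · rw [diag_evn, map_smul, dRed_evn]; simp
  · rw [diag_fn, dRed_fn, dRed_fn]
    simp only [map_add, map_mul, diag_odd, diag_fn, hF, hL, hR, hW, hWh, hb, fn_smul, smul_add, mul_add,
      mul_smul_comm, smul_mul_assoc, smul_smul]
    rw [mul_comm aF, mul_comm aL, mul_comm aR, h1, h2, h4,
      show aWh * b * c .vL = r by rw [← h3]; ring, show aW * b * c .vR = r by rw [← h5]; ring]

theorem dFerm_diag {c e φ} {r x wl wm : ℂ} (hx : ∀ a i, c (.eta a i) = x) (hy : ∀ i a, c (.theta i a) = x)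
    (hl : ∀ k, φ (up lam k) = wl • up lam k) (hm : ∀ k, φ (up mu k) = wm • up mu k)
    (h1 : ∀ i, e (.vEta i) * wl = r * x) (h2 : ∀ i, e (.vTheta i) * wm = r * x) (a : Form) :
    diag c e φ (dFerm a) = r • dFerm (diag c e φ a) := by
  refine dFerm_isOddDer.diag _ _ _ _ (fun k => ?_) (fun k => ?_) (fun f => ?_) a
  · rw [diag_odd, map_smul]
    cases k with
    | vF => simp [dFerm_vF]
    | vL => simp [dFerm_vL]
    | vR => simp [dFerm_vR]
    | eta a i =>
      rw [dFerm_eta, map_mul, diag_evn, diag_fn, hl, fn_smul, smul_mul_smul_comm, h1, hx, smul_smul]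
    | theta i a =>
      rw [dFerm_theta, map_mul, diag_evn, diag_fn, hm, fn_smul, smul_mul_smul_comm, h2, hy, smul_smul]
  · rw [diag_evn, map_smul, dFerm_evn]; simp
  · rw [diag_fn, dFerm_fn, dFerm_fn]; simp

/-! ### Degree, homogeneity and parity -/

/-- The action of `(r, t, s)` on forms: `r` scales a one-form by `r`, and `(t, s)` rescales the
homogeneous coordinates `(lam, mu)` to `(t lam, s mu)`, with the induced weights of the basis
one-forms; the coordinates `η^α_i`, `θ^{iα}` are invariant. -/
def torus (r t s : ℂˣ) : Form →ₐ[ℂ] Form :=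
  diag
    (fun
      | .vF => r * (t : ℂ)⁻¹ * (s : ℂ)⁻¹
      | .vL => r * ((t : ℂ) ^ 2)⁻¹
      | .vR => r * ((s : ℂ) ^ 2)⁻¹
      | .eta _ _ => 1
      | .theta _ _ => 1)
    (fun
      | .vEta _ => r * (t : ℂ)⁻¹
      | .vTheta _ => r * (s : ℂ)⁻¹)
    (scaleS t s)

/-- The parity automorphism: the fermionic coordinates and their differentials change sign. -/
def parity : Form →ₐ[ℂ] Form :=
  diag
    (fun
      | .eta _ _ => -1
      | .theta _ _ => -1
      | _ => 1)
    (fun _ => -1) (AlgHom.id ℂ Smooth)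

theorem torus_thetaEta (r t s : ℂˣ) : (∀ i, torus r t s (etaLow i) = (t : ℂ) • etaLow i) ∧
    (∀ i, torus r t s (thetaUp i) = ((1 : ℂ) * s) • thetaUp i) ∧
    torus r t s thetaEta = ((t : ℂ) * s) • thetaEta :=
  diag_thetaEta (x := 1) (fun _ _ => rfl) (fun _ _ => rfl) (fun _ => rfl) (fun _ => rfl) (by simp)
    (by ring)

theorem parity_thetaEta : (∀ i, parity (etaLow i) = (-1 : ℂ) • etaLow i) ∧
    (∀ i, parity (thetaUp i) = ((-1 : ℂ) * 1) • thetaUp i) ∧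
    parity thetaEta = (1 : ℂ) • thetaEta :=
  diag_thetaEta (x := -1) (wl := 1) (wm := 1) (fun _ _ => rfl) (fun _ _ => rfl) (by simp) (by simp)
    (by simp) (by simp)

theorem torus_dRed (r t s : ℂˣ) (a : Form) :
    torus r t s (dRed a) = (r : ℂ) • dRed (torus r t s a) := by
  have ht := t.ne_zero
  have hs := s.ne_zero
  refine dRed_diag (scaleS_hEF t s) (scaleS_hEL t s) (scaleS_hER t s) (scaleS_eW t s) (scaleS_eWhat t s)
    (torus_thetaEta r t s).2.2 ?_ ?_ ?_ ?_ ?_ ?_ a <;> field_simp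

theorem torus_dFerm (r t s : ℂˣ) (a : Form) :
    torus r t s (dFerm a) = (r : ℂ) • dFerm (torus r t s a) := by
  have ht := t.ne_zero
  have hs := s.ne_zero
  refine dFerm_diag (x := 1) (wl := t) (wm := s) (fun _ _ => rfl) (fun _ _ => rfl)
    (fun k => by rw [scaleS_up]; exact up_smul _ lam k) (fun k => by rw [scaleS_up]; exact up_smul _ mu k)
    (fun i => ?_) (fun i => ?_) a <;> field_simp

theorem parity_dRed (a : Form) : parity (dRed a) = dRed (parity a) := by
  have : parity (dRed a) = (1 : ℂ) • dRed (parity a) := by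
    refine dRed_diag (b := 1) (aF := 1) (aL := 1) (aR := 1) (aW := 1) (aWh := 1) ?_ ?_ ?_ ?_ ?_
      parity_thetaEta.2.2 ?_ ?_ ?_ ?_ ?_ ?_ a <;> simp
  rwa [one_smul] at this

theorem parity_dFerm (a : Form) : parity (dFerm a) = dFerm (parity a) := by
  have : parity (dFerm a) = (1 : ℂ) • dFerm (parity a) := by
    refine dFerm_diag (x := -1) (wl := 1) (wm := 1) (fun _ _ => rfl) (fun _ _ => rfl) ?_ ?_ ?_ ?_ a <;> simp
  rwa [one_smul] at this

theorem sig_eq (a : Form) : torus (-1) 1 1 (parity a) = sig a := by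
  rw [torus, parity, diag_comp, sig]
  congr 2
  · funext k; cases k <;> simp
  · funext k; cases k <;> simp
  · ext f p
    change (f : cone → ℂ) _ = (f : cone → ℂ) p
    exact congrArg _ (Subtype.ext (by simp [scaleL_apply]))

theorem sig_dRed (a : Form) : sig (dRed a) = -dRed (sig a) := by
  rw [← sig_eq, ← sig_eq, parity_dRed, torus_dRed]; simp

theorem sig_dFerm (a : Form) : sig (dFerm a) = -dFerm (sig a) := by
  rw [← sig_eq, ← sig_eq, parity_dFerm, torus_dFerm]; simp

theorem torus_dTw (r t s : ℂˣ) (a : Form) : torus r t s (dTw a) = (r : ℂ) • dTw (torus r t s a) := by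
  simp only [dTw, LinearMap.add_apply, map_add, torus_dRed, torus_dFerm, smul_add]

theorem parity_dTw (a : Form) : parity (dTw a) = dTw (parity a) := by
  simp only [dTw, LinearMap.add_apply, map_add, parity_dRed, parity_dFerm]

theorem sig_dTw (a : Form) : sig (dTw a) = -dTw (sig a) := by
  simp only [dTw, LinearMap.add_apply, map_add, sig_dRed, sig_dFerm, neg_add]

theorem dRed_dRed (a : Form) : dRed (dRed a) = 0 := by
  have h := sq_aux dRed_isOddDer (by simp [dRed_odd]) (by simp [dRed_odd]) (by simp [dRed_odd])
    dRed_thetaEta fun _ => rfl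
  refine dRed_isOddDer.sq sig_dRed (fun k => ?_) (fun k => ?_) h.2 a
  · by_cases hk : k = .vF
    · subst hk; exact h.1
    · rw [dRed_odd, if_neg hk, map_zero]
  · rw [dRed_evn, map_zero]

theorem dTw_dTw (a : Form) : dTw (dTw a) = 0 := by
  have h := sq_aux dTw_isOddDer (by simp [dTw, dRed_odd, dFerm_vF]) (by simp [dTw, dRed_odd, dFerm_vL])
    (by simp [dTw, dRed_odd, dFerm_vR]) (by simp [dTw, dRed_thetaEta, dFerm_thetaEta]) dTw_fn
  have hl : ∀ k, dTw (fn (up lam k)) = 0 := fun k => by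
    fin_cases k
    · have : dTw (fn (-lam 1)) = 0 := by
        rw [← neg_one_smul ℂ, fn_smul, map_smul, dTw_fn, dRed_lam, smul_zero]
      exact this
    · exact (dTw_fn _).trans (dRed_lam _)
  have hm : ∀ k, dTw (fn (up mu k)) = 0 := fun k => by
    fin_cases k
    · have : dTw (fn (-mu 1)) = 0 := by
        rw [← neg_one_smul ℂ, fn_smul, map_smul, dTw_fn, dRed_mu, smul_zero]
      exact this
    · exact (dTw_fn _).trans (dRed_mu _)
  refine dTw_isOddDer.sq sig_dTw (fun k => ?_) (fun k => ?_) h.2 a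
  · cases k with
    | vF => exact h.1
    | vL => simp [dTw, dRed_odd, dFerm_vL]
    | vR => simp [dTw, dRed_odd, dFerm_vR]
    | eta a i =>
      have : dTw (odd (.eta a i)) = evn (.vEta i) * fn (up lam a) := by
        rw [dTw, LinearMap.add_apply, dRed_odd, dFerm_eta]; simp
      rw [this, dTw_isOddDer, dTw_evn, hl]; simp
    | theta i a =>
      have : dTw (odd (.theta i a)) = evn (.vTheta i) * fn (up mu a) := by
        rw [dTw, LinearMap.add_apply, dRed_odd, dFerm_theta]; simp
      rw [this, dTw_isOddDer, dTw_evn, hm]; simp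
  · rw [dTw_evn, map_zero]

/-- The sign `(-1)^a`. -/
def sgn (a : ZMod 2) : ℂ := if a = 0 then 1 else -1

theorem sgn_zero : sgn 0 = 1 := if_pos rfl

theorem sgn_one : sgn 1 = -1 := if_neg one_ne_zero

theorem sgn_add (a b : ZMod 2) : sgn (a + b) = sgn a * sgn b := by
  have h : ∀ a : ZMod 2, a = 0 ∨ a = 1 := by decide
  rcases h a with rfl | rfl <;> rcases h b with rfl | rfl <;>
    simp [sgn_zero, sgn_one, show (1 + 1 : ZMod 2) = 0 from rfl]

theorem sgn_natCast (p : ℕ) : sgn p = (-1) ^ p := by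
  induction p with
  | zero => simp [sgn_zero]
  | succ n ih => rw [Nat.cast_succ, sgn_add, ih, sgn_one, pow_succ]

theorem sgn_mul_self (a : ZMod 2) : sgn a * sgn a = 1 := by
  rw [← sgn_add, CharTwo.add_self_eq_zero, sgn_zero]

theorem sgn_eq (a : ZMod 2) : sgn a = 1 ∨ sgn a = -1 := by
  unfold sgn; split_ifs <;> simp

/-- The twisted CR forms of degree `p` and parity `a` (`a = 0` bosonic, `a = 1` fermionic) on
`ℝ⁴ × ℂP¹ × ℂP¹` with its fermionic coordinates: the forms on the cone which are invariant under
rescalings of the homogeneous coordinates. -/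
def Omega (p : ℕ) (a : ZMod 2) : Submodule ℂ Form where
  carrier := {w | (∀ r t s : ℂˣ, torus r t s w = ((r : ℂ) ^ p) • w) ∧ parity w = sgn a • w}
  zero_mem' := by simp
  add_mem' := fun {x y} hx hy => ⟨fun r t s => by rw [map_add, hx.1, hy.1, smul_add],
    by rw [map_add, hx.2, hy.2, smul_add]⟩
  smul_mem' := fun c x hx => ⟨fun r t s => by rw [map_smul, hx.1, smul_comm],
    by rw [map_smul, hx.2, smul_comm]⟩

theorem mem_Omega {p a} {w : Form} : w ∈ Omega p a ↔
    (∀ r t s : ℂˣ, torus r t s w = ((r : ℂ) ^ p) • w) ∧ parity w = sgn a • w := Iff.rfl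

theorem sig_Omega {p a} {w : Form} (h : w ∈ Omega p a) : sig w = sgn (p + a) • w := by
  rw [← sig_eq, h.2, map_smul, h.1, smul_smul, sgn_add, sgn_natCast, mul_comm]; simp

theorem mul_mem_Omega {p q a b} {x y : Form} (hx : x ∈ Omega p a) (hy : y ∈ Omega q b) :
    x * y ∈ Omega (p + q) (a + b) :=
  ⟨fun r t s => by rw [map_mul, hx.1, hy.1, smul_mul_smul_comm, pow_add],
    by rw [map_mul, hx.2, hy.2, smul_mul_smul_comm, sgn_add]⟩

theorem Omega_comm {p q a b} {x y : Form} (hx : x ∈ Omega p a) (hy : y ∈ Omega q b) :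
    x * y = sgn ((p + a) * (q + b)) • (y * x) := by
  have hz : ∀ z : ZMod 2, z = 0 ∨ z = 1 := by decide
  have h1 := sig_Omega hx
  have h2 := sig_Omega hy
  rcases hz (q + b) with h | h
  · rw [h, sgn_zero, one_smul] at h2
    rw [h, mul_zero, sgn_zero, one_smul, (mul_even_odd x).1 y h2]
  · rw [h, sgn_one, neg_smul, one_smul] at h2
    rw [h, mul_one, (mul_even_odd x).2 y h2, h1, mul_smul_comm]

theorem dTw_mem_Omega {p a} {x : Form} (hx : x ∈ Omega p a) : dTw x ∈ Omega (p + 1) a :=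
  ⟨fun r t s => by rw [torus_dTw, hx.1, map_smul, smul_smul, pow_succ, mul_comm],
    by rw [parity_dTw, hx.2, map_smul]⟩

theorem dRed_mem_Omega {p a} {x : Form} (hx : x ∈ Omega p a) : dRed x ∈ Omega (p + 1) a :=
  ⟨fun r t s => by rw [torus_dRed, hx.1, map_smul, smul_smul, pow_succ, mul_comm],
    by rw [parity_dRed, hx.2, map_smul]⟩

/-- The subalgebra generated by the bosonic one-forms, the functions of the bosonic coordinates and
the fermionic coordinates `η_i` and `θ^i`. -/
def redAlg : Subalgebra ℂ Form :=
  Algebra.adjoin ℂ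
    ({odd .vF, odd .vL, odd .vR} ∪ Set.range etaLow ∪ Set.range thetaUp ∪ Set.range fn)

theorem redAlg_induction {C : Form → Prop} (hF : C (odd .vF)) (hL : C (odd .vL)) (hR : C (odd .vR))
    (he : ∀ i, C (etaLow i)) (ht : ∀ i, C (thetaUp i)) (hf : ∀ f, C (fn f))
    (hadd : ∀ x ∈ redAlg, ∀ y ∈ redAlg, C x → C y → C (x + y))
    (hmul : ∀ x ∈ redAlg, ∀ y ∈ redAlg, C x → C y → C (x * y)) {x : Form} (hx : x ∈ redAlg) : C x := by
  refine Algebra.adjoin_induction (p := fun x _ => C x) ?_ (fun r => ?_)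
    (fun x y hx hy => hadd x hx y hy) (fun x y hx hy => hmul x hx y hy) hx
  · rintro x (((((h | h | h) | ⟨i, rfl⟩) | ⟨i, rfl⟩)) | ⟨f, rfl⟩)
    · rw [h]; exact hF
    · rw [h]; exact hL
    · rw [h]; exact hR
    · exact he i
    · exact ht i
    · exact hf f
  · rw [Algebra.algebraMap_eq_smul_one, ← fn_one, ← fn_smul]; exact hf _

theorem vF_mem : odd .vF ∈ redAlg := Algebra.subset_adjoin (by simp)
theorem vL_mem : odd .vL ∈ redAlg := Algebra.subset_adjoin (by simp)
theorem vR_mem : odd .vR ∈ redAlg := Algebra.subset_adjoin (by simp)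
theorem etaLow_mem (i) : etaLow i ∈ redAlg := Algebra.subset_adjoin (by simp)
theorem thetaUp_mem (i) : thetaUp i ∈ redAlg := Algebra.subset_adjoin (by simp)
theorem fn_mem (f) : fn f ∈ redAlg := Algebra.subset_adjoin (by simp)

theorem thetaEta_mem : thetaEta ∈ redAlg :=
  sum_mem fun i _ => mul_mem (thetaUp_mem i) (etaLow_mem i)

theorem dFerm_redAlg {x : Form} (hx : x ∈ redAlg) : dFerm x = 0 := by
  refine redAlg_induction (C := fun x => dFerm x = 0) dFerm_vF dFerm_vL dFerm_vR dFerm_etaLow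
    dFerm_thetaUp dFerm_fn (fun x _ y _ hx hy => ?_) (fun x _ y _ hx hy => ?_) hx
  · rw [map_add, hx, hy, add_zero]
  · rw [dFerm_isOddDer, hx, hy, zero_mul, mul_zero, add_zero]

theorem sig_redAlg {x : Form} (hx : x ∈ redAlg) : sig x ∈ redAlg := by
  refine redAlg_induction (C := fun x => sig x ∈ redAlg) ?_ ?_ ?_ (fun i => ?_)
    (fun i => ?_) (fun f => ?_) (fun x _ y _ hx hy => ?_) (fun x _ y _ hx hy => ?_) hx
  · rw [sig_odd]; exact neg_mem vF_mem
  · rw [sig_odd]; exact neg_mem vL_mem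
  · rw [sig_odd]; exact neg_mem vR_mem
  · rw [sig_etaLow]; exact neg_mem (etaLow_mem i)
  · rw [sig_thetaUp]; exact neg_mem (thetaUp_mem i)
  · rw [sig_fn]; exact fn_mem f
  · rw [map_add]; exact add_mem hx hy
  · rw [map_mul]; exact mul_mem hx hy

theorem dRed_redAlg {x : Form} (hx : x ∈ redAlg) : dRed x ∈ redAlg := by
  refine redAlg_induction (C := fun x => dRed x ∈ redAlg) ?_ ?_ ?_ (fun i => ?_)
    (fun i => ?_) (fun f => ?_) (fun x _ y _ hx hy => ?_) (fun x hx' y hy' hx hy => ?_) hx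
  · rw [dRed_odd, if_pos rfl]
    exact Subalgebra.smul_mem _ (mul_mem (mul_mem vL_mem vR_mem) thetaEta_mem) _
  · rw [dRed_odd, if_neg (by simp)]; exact zero_mem _
  · rw [dRed_odd, if_neg (by simp)]; exact zero_mem _
  · rw [dRed_etaLow]; exact zero_mem _
  · rw [dRed_thetaUp]; exact zero_mem _
  · rw [dRed_fn]
    exact add_mem (add_mem (mul_mem vF_mem (fn_mem _))
      (mul_mem vL_mem (add_mem (fn_mem _) (mul_mem thetaEta_mem (fn_mem _)))))
      (mul_mem vR_mem (add_mem (fn_mem _) (mul_mem thetaEta_mem (fn_mem _))))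
  · rw [map_add]; exact add_mem hx hy
  · rw [dRed_isOddDer]; exact add_mem (mul_mem hx hy') (mul_mem (sig_redAlg hx') hy)

/-- The reduced forms of degree `p`, homogeneity zero and parity `a`. -/
def OmegaRed (p : ℕ) (a : ZMod 2) : Submodule ℂ Form := Omega p a ⊓ Subalgebra.toSubmodule redAlg

/-! ### Differential graded Lie superalgebras -/

/-- Differential graded Lie superalgebras over `ℂ`, in non-negative degrees.  An element of `X p a`
has degree `p` and parity `a`; exchanging elements of `X p a` and `X q b` gives the sign
`(-1)^(p q + a b)`.  The indices `r` and `c` of the target of the bracket are fixed by `p + q = r`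
and `a + b = c`. -/
structure DGLieSuperalgebra where
  /-- the components -/
  X : ℕ → ZMod 2 → Type u
  [grp : ∀ p a, AddCommGroup (X p a)]
  [mod : ∀ p a, Module ℂ (X p a)]
  /-- the differential -/
  d : ∀ p a, X p a →ₗ[ℂ] X (p + 1) a
  d_d : ∀ p a x, d (p + 1) a (d p a x) = 0
  /-- the bracket -/
  br : ∀ {p q r : ℕ} {a b c : ZMod 2}, p + q = r → a + b = c → X p a →ₗ[ℂ] X q b →ₗ[ℂ] X r c
  antisymm : ∀ {p q r : ℕ} {a b c : ZMod 2} (h : p + q = r) (k : a + b = c) (x : X p a) (y : X q b),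
    br h k x y = -sgn (p * q + a * b) • br ((add_comm q p).trans h) ((add_comm b a).trans k) y x
  jacobi : ∀ {p q r pq qr pr n : ℕ} {a b c ab bc ac m : ZMod 2}
    (h₁ : p + q = pq) (h₂ : q + r = qr) (h₃ : p + r = pr)
    (k₁ : a + b = ab) (k₂ : b + c = bc) (k₃ : a + c = ac)
    (l₁ : p + qr = n) (l₂ : pq + r = n) (l₃ : q + pr = n)
    (m₁ : a + bc = m) (m₂ : ab + c = m) (m₃ : b + ac = m)
    (x : X p a) (y : X q b) (z : X r c),
    br l₁ m₁ x (br h₂ k₂ y z) =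
      br l₂ m₂ (br h₁ k₁ x y) z + sgn (p * q + a * b) • br l₃ m₃ y (br h₃ k₃ x z)
  leibniz : ∀ {p q r : ℕ} {a b c : ZMod 2} (h : p + q = r) (k : a + b = c)
    (h₁ : p + 1 + q = r + 1) (h₂ : p + (q + 1) = r + 1) (x : X p a) (y : X q b),
    d r c (br h k x y) = br h₁ k (d p a x) y + sgn p • br h₂ k x (d q b y)

attribute [instance] DGLieSuperalgebra.grp DGLieSuperalgebra.mod

namespace DGLieSuperalgebra

/-- The parity `a` part of the underlying cochain complex. -/
def complex (L : DGLieSuperalgebra.{u}) (a : ZMod 2) : CochainComplex (ModuleCat.{u} ℂ) ℕ :=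
  CochainComplex.of (fun p => ModuleCat.of ℂ (L.X p a)) (fun p => ModuleCat.ofHom (L.d p a))
    fun p => by
      ext x
      exact L.d_d p a x

theorem complex_d (L : DGLieSuperalgebra.{u}) (a : ZMod 2) (p : ℕ) :
    (L.complex a).d p (p + 1) = ModuleCat.ofHom (L.d p a) :=
  CochainComplex.of_d (fun p => ModuleCat.of ℂ (L.X p a)) (fun p => ModuleCat.ofHom (L.d p a)) p

/-- Strict morphisms of differential graded Lie superalgebras. -/
structure Hom (L M : DGLieSuperalgebra.{u}) where
  toFun : ∀ p a, L.X p a →ₗ[ℂ] M.X p a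
  map_d : ∀ p a x, toFun (p + 1) a (L.d p a x) = M.d p a (toFun p a x)
  map_br : ∀ {p q r : ℕ} {a b c : ZMod 2} (h : p + q = r) (k : a + b = c) (x : L.X p a) (y : L.X q b),
    toFun r c (L.br h k x y) = M.br h k (toFun p a x) (toFun q b y)

/-- The cochain map underlying a morphism. -/
def Hom.complexMap {L M : DGLieSuperalgebra.{u}} (f : Hom L M) (a : ZMod 2) :
    L.complex a ⟶ M.complex a :=
  CochainComplex.ofHom (fun p => ModuleCat.ofHom (f.toFun p a)) fun p => by
    rw [complex_d, complex_d]
    ext x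
    exact (f.map_d p a x).symm

/-- A morphism is a quasi-isomorphism if it induces isomorphisms on all cohomology groups. -/
def Hom.IsQuasiIso {L M : DGLieSuperalgebra.{u}} (f : Hom L M) : Prop :=
  ∀ a, QuasiIso (f.complexMap a)

end DGLieSuperalgebra

/-- A differential graded algebra of forms of homogeneity zero. -/
structure FormDGA where
  carrier : ℕ → ZMod 2 → Submodule ℂ Form
  d : Form →ₗ[ℂ] Form
  le_Omega : ∀ p a, carrier p a ≤ Omega p a
  mul_mem : ∀ {p q a b} {x y : Form}, x ∈ carrier p a → y ∈ carrier q b → x * y ∈ carrier (p + q) (a + b)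
  d_mem : ∀ {p a} {x : Form}, x ∈ carrier p a → d x ∈ carrier (p + 1) a
  isOddDer : IsOddDer d
  d_d : ∀ x, d (d x) = 0

/-- The twisted CR forms `(Ω_tw, ∂̄_tw)`. -/
def twForms : FormDGA where
  carrier := Omega
  d := dTw
  le_Omega _ _ := le_rfl
  mul_mem := mul_mem_Omega
  d_mem := dTw_mem_Omega
  isOddDer := dTw_isOddDer
  d_d := dTw_dTw

/-- The reduced twisted CR forms `(Ω_tw,red, ∂̄_tw,red)`. -/
def redForms : FormDGA where
  carrier := OmegaRed
  d := dRed
  le_Omega _ _ := inf_le_left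
  mul_mem hx hy := ⟨mul_mem_Omega hx.1 hy.1, redAlg.mul_mem hx.2 hy.2⟩
  d_mem hx := ⟨dRed_mem_Omega hx.1, dRed_redAlg hx.2⟩
  isOddDer := dRed_isOddDer
  d_d := dRed_dRed

namespace FormDGA

variable (A : FormDGA)

/-- The wedge product of forms of degrees `p`, `q` and parities `a`, `b`.  In the algebra `Form` signs
are governed by the total parity `p + a`; the factor `(-1)^(a q)` turns this into the product with
`x ∧ y = (-1)^(p q + a b) y ∧ x`. -/
def wedge {p q r : ℕ} {a b c : ZMod 2} (h : p + q = r) (k : a + b = c) :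
    A.carrier p a →ₗ[ℂ] A.carrier q b →ₗ[ℂ] A.carrier r c :=
  LinearMap.mk₂ ℂ
    (fun x y => sgn (a * q) •
      (⟨x * y, by subst h; subst k; exact A.mul_mem x.2 y.2⟩ : A.carrier r c))
    (fun x y z => by ext; simp [add_mul])
    (fun t x y => by ext; simp [smul_comm t])
    (fun x y z => by ext; simp [mul_add])
    (fun t x y => by ext; simp [smul_comm t])

theorem wedge_coe {p q r : ℕ} {a b c : ZMod 2} (h : p + q = r) (k : a + b = c)
    (x : A.carrier p a) (y : A.carrier q b) :
    (A.wedge h k x y : Form) = sgn (a * q) • ((x : Form) * (y : Form)) := rfl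

/-- The differential. -/
def der (p : ℕ) (a : ZMod 2) : A.carrier p a →ₗ[ℂ] A.carrier (p + 1) a :=
  A.d.restrict fun _ hx => A.d_mem hx

theorem der_coe (p : ℕ) (a : ZMod 2) (x : A.carrier p a) : (A.der p a x : Form) = A.d x := rfl

theorem wedge_comm {p q r : ℕ} {a b c : ZMod 2} (h : p + q = r) (k : a + b = c)
    (h' : q + p = r) (k' : b + a = c) (x : A.carrier p a) (y : A.carrier q b) :
    A.wedge h k x y = sgn (p * q + a * b) • A.wedge h' k' y x := by
  ext
  rw [SetLike.val_smul, wedge_coe, wedge_coe, Omega_comm (A.le_Omega _ _ x.2) (A.le_Omega _ _ y.2),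
    smul_smul, smul_smul, ← sgn_add, ← sgn_add]
  congr 2
  linear_combination (a * q) * (CharTwo.two_eq_zero : (2 : ZMod 2) = 0)

theorem wedge_assoc {p q r pq qr n : ℕ} {a b c ab bc m : ZMod 2}
    (h₁ : p + q = pq) (h₂ : q + r = qr) (k₁ : a + b = ab) (k₂ : b + c = bc)
    (l₁ : p + qr = n) (l₂ : pq + r = n) (m₁ : a + bc = m) (m₂ : ab + c = m)
    (x : A.carrier p a) (y : A.carrier q b) (z : A.carrier r c) :
    A.wedge l₁ m₁ x (A.wedge h₂ k₂ y z) = A.wedge l₂ m₂ (A.wedge h₁ k₁ x y) z := by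
  subst h₂ k₁
  ext
  simp only [wedge_coe, mul_smul_comm, smul_mul_assoc, smul_smul, ← sgn_add, mul_assoc]
  congr 2
  push_cast
  ring

theorem wedge_der {p q r : ℕ} {a b c : ZMod 2} (h : p + q = r) (k : a + b = c)
    (h₁ : p + 1 + q = r + 1) (h₂ : p + (q + 1) = r + 1) (x : A.carrier p a) (y : A.carrier q b) :
    A.der r c (A.wedge h k x y) =
      A.wedge h₁ k (A.der p a x) y + sgn p • A.wedge h₂ k x (A.der q b y) := by
  ext
  rw [Submodule.coe_add, SetLike.val_smul, der_coe, wedge_coe, wedge_coe, wedge_coe, der_coe, der_coe,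
    map_smul, A.isOddDer, sig_Omega (A.le_Omega _ _ x.2), smul_add, smul_mul_assoc, smul_smul, smul_smul,
    ← sgn_add, ← sgn_add]
  congr 3
  push_cast
  ring

variable (g : Type u) [LieRing g] [LieAlgebra ℂ g]

/-- The bracket on forms with values in a Lie algebra, `[x ⊗ u, y ⊗ v] = (x ∧ y) ⊗ [u, v]`. -/
def bracket {p q r : ℕ} {a b c : ZMod 2} (h : p + q = r) (k : a + b = c) :
    A.carrier p a ⊗[ℂ] g →ₗ[ℂ] A.carrier q b ⊗[ℂ] g →ₗ[ℂ] A.carrier r c ⊗[ℂ] g :=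
  TensorProduct.map₂ (A.wedge h k) (LieModule.toEnd ℂ g g : g →ₗ[ℂ] Module.End ℂ g)

theorem bracket_tmul {p q r : ℕ} {a b c : ZMod 2} (h : p + q = r) (k : a + b = c)
    (x : A.carrier p a) (y : A.carrier q b) (u v : g) :
    A.bracket g h k (x ⊗ₜ u) (y ⊗ₜ v) = A.wedge h k x y ⊗ₜ ⁅u, v⁆ := rfl

/-- The differential graded Lie superalgebra of forms with values in a Lie algebra. -/
def lie : DGLieSuperalgebra.{u} where
  X p a := A.carrier p a ⊗[ℂ] g
  d p a := (A.der p a).rTensor g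
  d_d p a x := by
    rw [← LinearMap.comp_apply, ← LinearMap.rTensor_comp]
    have : A.der (p + 1) a ∘ₗ A.der p a = 0 := by ext x; exact A.d_d x
    rw [this, LinearMap.rTensor_zero, LinearMap.zero_apply]
  br := A.bracket g
  antisymm h k x y := by
    induction x using TensorProduct.induction_on with
    | zero => simp
    | add x x' hx hx' => simp only [map_add, LinearMap.add_apply, smul_add, hx, hx']
    | tmul x u =>
      induction y using TensorProduct.induction_on with
      | zero => simp
      | add y y' hy hy' => simp only [map_add, LinearMap.add_apply, smul_add, hy, hy']
      | tmul y v =>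
        rw [bracket_tmul, bracket_tmul, A.wedge_comm h k ((add_comm _ _).trans h) ((add_comm _ _).trans k),
          ← lie_skew, TensorProduct.tmul_neg, neg_smul, TensorProduct.smul_tmul']
  jacobi h₁ h₂ h₃ k₁ k₂ k₃ l₁ l₂ l₃ m₁ m₂ m₃ x y z := by
    induction x using TensorProduct.induction_on with
    | zero => simp
    | add x x' hx hx' => simp only [map_add, LinearMap.add_apply, smul_add, hx, hx']; abel
    | tmul x u =>
      induction y using TensorProduct.induction_on with
      | zero => simp
      | add y y' hy hy' => simp only [map_add, LinearMap.add_apply, smul_add, hy, hy']; abel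
      | tmul y v =>
        induction z using TensorProduct.induction_on with
        | zero => simp
        | add z z' hz hz' => simp only [map_add, smul_add, hz, hz']; abel
        | tmul z w =>
          simp only [bracket_tmul]
          rw [A.wedge_assoc h₁ h₂ k₁ k₂ l₁ l₂ m₁ m₂,
            A.wedge_assoc ((add_comm _ _).trans h₁) h₃ ((add_comm _ _).trans k₁) k₃ l₃ l₂ m₃ m₂,
            A.wedge_comm h₁ k₁ ((add_comm _ _).trans h₁) ((add_comm _ _).trans k₁) x y, leibniz_lie,
            TensorProduct.tmul_add, map_smul, LinearMap.smul_apply, TensorProduct.smul_tmul']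
  leibniz h k h₁ h₂ x y := by
    induction x using TensorProduct.induction_on with
    | zero => simp
    | add x x' hx hx' => simp only [map_add, LinearMap.add_apply, smul_add, hx, hx']; abel
    | tmul x u =>
      induction y using TensorProduct.induction_on with
      | zero => simp
      | add y y' hy hy' => simp only [map_add, smul_add, hy, hy']; abel
      | tmul y v =>
        simp only [bracket_tmul, LinearMap.rTensor_tmul]
        rw [A.wedge_der h k h₁ h₂, TensorProduct.add_tmul, TensorProduct.smul_tmul']

variable {A} {B : FormDGA}

/-- An inclusion of differential graded algebras of forms induces a morphism of differential graded
Lie superalgebras. -/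
def lieHom (hle : ∀ p a, A.carrier p a ≤ B.carrier p a)
    (hd : ∀ p a, ∀ x ∈ A.carrier p a, A.d x = B.d x) : (A.lie g).Hom (B.lie g) where
  toFun p a := (Submodule.inclusion (hle p a)).rTensor g
  map_d p a x := by
    have h : Submodule.inclusion (hle (p + 1) a) ∘ₗ A.der p a =
        B.der p a ∘ₗ Submodule.inclusion (hle p a) := by
      ext x
      exact hd p a x x.2
    have h' := congrArg (LinearMap.rTensor g) h
    rw [LinearMap.rTensor_comp, LinearMap.rTensor_comp] at h'
    exact LinearMap.congr_fun h' x
  map_br {p q r a b c} h k x y := by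
    have key : ∀ (x : A.carrier p a ⊗[ℂ] g) (y : A.carrier q b ⊗[ℂ] g),
        (Submodule.inclusion (hle r c)).rTensor g (A.bracket g h k x y) =
          B.bracket g h k ((Submodule.inclusion (hle p a)).rTensor g x)
            ((Submodule.inclusion (hle q b)).rTensor g y) := fun x y => by
      induction x using TensorProduct.induction_on with
      | zero => simp
      | add x x' hx hx' => simp only [map_add, LinearMap.add_apply, hx, hx']
      | tmul x u =>
        induction y using TensorProduct.induction_on with
        | zero => simp
        | add y y' hy hy' => simp only [map_add, hy, hy']
        | tmul y v => rfl
    exact key x y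

end FormDGA

/-- The differential graded Lie superalgebra `(Ω_tw ⊗ g, ∂̄_tw, [-,-])`. -/
def twL (g : Type u) [LieRing g] [LieAlgebra ℂ g] : DGLieSuperalgebra.{u} := twForms.lie g

/-- The differential graded Lie superalgebra `(Ω_tw,red ⊗ g, ∂̄_tw,red, [-,-])`. -/
def redL (g : Type u) [LieRing g] [LieAlgebra ℂ g] : DGLieSuperalgebra.{u} := redForms.lie g

/-- The inclusion of reduced forms into all forms, as a strict morphism of differential graded
Lie superalgebras. -/
def wittenInclusion (g : Type u) [LieRing g] [LieAlgebra ℂ g] : (redL g).Hom (twL g) :=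
  FormDGA.lieHom g (fun _ _ => inf_le_left) fun _ _ x hx => by
    have h : dFerm x = 0 := dFerm_redAlg hx.2
    change dRed x = dRed x + dFerm x
    rw [h, add_zero]

end CRAmbitwistor

end

noncomputable section

namespace CRAmbitwistor

/-! ### Complementary fermionic coordinates -/

/-! The fermionic part of the differential is a Koszul differential. At each point the spinors `λ`
and `λ̂` form a basis, because `|λ|²` never vanishes. The two coordinates `η^α_i` can therefore be
traded for `η_i`, which `V̂^i` annihilates, and a complement `etaHat i`, which `V̂^i` sends to one.
The same holds for `θ` with `μ`. So `v̂_i` and `v̂^i` are the fermionic differentials of `etaHat`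
and `thetaHat`. The full algebra of forms is then generated over `redAlg` by the pairs (`etaHat`,
`dTw etaHat`) and (`thetaHat`, `dTw thetaHat`). Each such pair is contractible, so only the reduced
forms survive in cohomology.

The contraction is made explicit by the odd derivation `contr`, which sends `v̂_i` to `etaHat i` and
`v̂^i` to `thetaHat i`. Its anticommutator with `dTw` is the even derivation `count`. It vanishes on
`redAlg`, has eigenvalue one on `etaHat` and `thetaHat`, and commutes with `dTw`; hence it counts
complementary generators. The algebra splits as `redAlg` plus the span `posPart` of the eigenvectors
with positive integer eigenvalue (`exists_redAlg_add_posPart`, `isCompl_redAlg_posPart`). No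
freeness over `redAlg` is needed: generation gives the sum, and independence of eigenspaces makes it
direct.

On `posPart` the operator `count` is invertible. With its inverse extended by zero to `countInv`,
the map `contr ∘ countInv` is a homotopy between the identity and the projection `1 - count ∘
countInv` onto `redAlg` (`homotopy_zero`, `homotopy_succ`). All operators respect the torus and
parity actions, so they descend to global forms of fixed degree and homogeneity zero. In degree zero
the homotopy formula also needs that there are no forms of degree `-1` (`contr_Omega_zero`).
Tensoring the resulting deformation retraction with the Lie algebra gives the theorem; the bracket
plays no role in the cohomological statement. -/

/-- The fermionic coordinate `- η^α_i lamHat_α / |lam|²`, complementary to `η_i`. -/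
def etaHat (i : Fin 3) : Form := ∑ a, odd (.eta a i) * fn (-(hat lam a * invLam))

/-- The fermionic coordinate `- θ^{iα} muHat_α / |mu|²`, complementary to `θ^i`. -/
def thetaHat (i : Fin 3) : Form := ∑ a, odd (.theta i a) * fn (-(hat mu a * invMu))

theorem etaHat_mul (i : Fin 3) (a : Form) : etaHat i * a = sig a * etaHat i :=
  sum_odd_mul _ (fun _ => odd_mul_fn _ _) a

theorem thetaHat_mul (i : Fin 3) (a : Form) : thetaHat i * a = sig a * thetaHat i :=
  sum_odd_mul _ (fun _ => odd_mul_fn _ _) a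

/-! ### Expansion of spinors in the basis `s`, `ŝ` -/

theorem nrm_eq (s : Fin 2 → Smooth) : nrm s = s 1 * hat s 0 - s 0 * hat s 1 := by
  simp only [nrm, Fin.sum_univ_two, up_zero, up_one]; ring

/-- Moving a contracted spinor index costs a sign: `s^α ŝ_α = - s_α ŝ^α = - |s|²`. This accounts for
the minus sign in `etaHat` and `thetaHat`, which normalises their fermionic derivatives to one. -/
theorem sum_up_mul_hat {s : Fin 2 → Smooth} {n : Smooth} (h : nrm s * n = 1) :
    ∑ a, up s a * -(hat s a * n) = 1 := by
  rw [← h, nrm_eq]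
  simp only [Fin.sum_univ_two, up_zero, up_one]; ring

/-- The expansion of unit spinors in the basis `s`, `ŝ`. -/
theorem spinor_completeness {s : Fin 2 → Smooth} {n : Smooth} (h : nrm s * n = 1) (a b : Fin 2) :
    s b * (up (hat s) a * n) + -(hat s b * n) * up s a = if b = a then 1 else 0 := by
  rw [nrm_eq] at h
  -- The diagonal entries are the normalisation `h`; the off-diagonal ones cancel identically.
  fin_cases a <;> fin_cases b <;> simp [up_zero, up_one] <;> first | linear_combination h | ring

/-- The expansion of anticommuting generators in the basis `s`, `ŝ`. -/
theorem odd_eq_completeness {s : Fin 2 → Smooth} {n : Smooth} (h : nrm s * n = 1)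
    (k : Fin 2 → OddGen) (a : Fin 2) :
    odd (k a) = (∑ b, odd (k b) * fn (s b)) * fn (up (hat s) a * n) +
      (∑ b, odd (k b) * fn (-(hat s b * n))) * fn (up s a) := by
  simp only [Finset.sum_mul, mul_assoc, ← fn_mul, ← Finset.sum_add_distrib, ← mul_add, ← fn_add,
    spinor_completeness h]
  rw [Finset.sum_eq_single a (fun b _ hb => by rw [if_neg hb, fn_zero, mul_zero]) (by simp),
    if_pos rfl, fn_one, mul_one]

theorem odd_eta_eq (a : Fin 2) (i : Fin 3) :
    odd (.eta a i) = etaLow i * fn (up (hat lam) a * invLam) + etaHat i * fn (up lam a) :=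
  odd_eq_completeness invLam_mul (fun a => .eta a i) a

theorem odd_theta_eq (i : Fin 3) (a : Fin 2) :
    odd (.theta i a) = thetaUp i * fn (up (hat mu) a * invMu) + thetaHat i * fn (up mu a) :=
  odd_eq_completeness invMu_mul (fun a => .theta i a) a

/-! ### Differentials of the complementary coordinates -/

/-- This is the exactness of the fermionic one-forms that drives the whole argument. -/
theorem dFerm_etaHat (i : Fin 3) : dFerm (etaHat i) = evn (.vEta i) := by
  simp only [etaHat, map_sum, dFerm_isOddDer _ _, dFerm_eta, dFerm_fn, mul_zero, add_zero, mul_assoc,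
    ← fn_mul]
  rw [← Finset.mul_sum, ← fn_sum, sum_up_mul_hat invLam_mul, fn_one, mul_one]

theorem dFerm_thetaHat (i : Fin 3) : dFerm (thetaHat i) = evn (.vTheta i) := by
  simp only [thetaHat, map_sum, dFerm_isOddDer _ _, dFerm_theta, dFerm_fn, mul_zero, add_zero,
    mul_assoc, ← fn_mul]
  rw [← Finset.mul_sum, ← fn_sum, sum_up_mul_hat invMu_mul, fn_one, mul_one]

theorem transl_hat_lam (c : Fin 2 → Fin 2 → Smooth) (k : Fin 2) :
    transl c (hat lam k * invLam) = 0 := by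
  simp [transl_apply, dX_hat_lam, dX_invLam]

theorem transl_hat_mu (c : Fin 2 → Fin 2 → Smooth) (k : Fin 2) :
    transl c (hat mu k * invMu) = 0 := by
  simp [transl_apply, dX_hat_mu, dX_invMu]

theorem hER_invLam : hER invLam = 0 := der_invS _ _ _ hER_nrm_lam

theorem hEL_invMu : hEL invMu = 0 := der_invS _ _ _ hEL_nrm_mu

/-- Only `Ê_L` sees this function: it depends neither on `x` nor on `μ`. The factor `|λ|²` in `Ê_L`
cancels the `1/|λ|²` and leaves `λ_k`. -/
theorem dRed_hat_lam (k : Fin 2) : dRed (fn (-(hat lam k * invLam))) = -(odd .vL * fn (lam k)) := by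
  have h : hEL (hat lam k * invLam) = lam k := by
    rw [Derivation.leibniz, hEL_invLam, hEL_hat_lam, smul_zero, zero_add, smul_eq_mul]
    linear_combination lam k * invLam_mul
  have hR : hER (hat lam k * invLam) = 0 := by
    rw [Derivation.leibniz, hER_invLam, hER_hat_lam, smul_zero, smul_zero, zero_add]
  rw [← neg_one_smul ℂ (_ * _), fn_smul, map_smul, dRed_fn, h, hR, hEF_eq, eW_eq, eWhat_eq,
    transl_hat_lam, transl_hat_lam, transl_hat_lam]
  simp [fn_zero]

theorem dRed_hat_mu (k : Fin 2) : dRed (fn (-(hat mu k * invMu))) = -(odd .vR * fn (mu k)) := by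
  have h : hER (hat mu k * invMu) = mu k := by
    rw [Derivation.leibniz, hER_invMu, hER_hat_mu, smul_zero, zero_add, smul_eq_mul]
    linear_combination mu k * invMu_mul
  have hL : hEL (hat mu k * invMu) = 0 := by
    rw [Derivation.leibniz, hEL_invMu, hEL_hat_mu, smul_zero, smul_zero, zero_add]
  rw [← neg_one_smul ℂ (_ * _), fn_smul, map_smul, dRed_fn, h, hL, hEF_eq, eW_eq, eWhat_eq,
    transl_hat_mu, transl_hat_mu, transl_hat_mu]
  simp [fn_zero]

theorem dRed_etaHat (i : Fin 3) : dRed (etaHat i) = -(odd .vL * etaLow i) := by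
  simp only [etaHat, etaLow, map_sum, dRed_isOddDer _ _, dRed_odd, sig_odd, dRed_hat_lam,
    reduceCtorEq, if_false, zero_mul, zero_add, neg_mul_neg, Finset.mul_sum]
  rw [← Finset.sum_neg_distrib]
  refine Finset.sum_congr rfl fun a _ => ?_
  -- The sign from passing the differential over `η` has cancelled the sign in `dRed_hat_lam`; the
  -- remaining one comes from moving `v̂^L` to the front.
  rw [← mul_assoc, odd_anticomm, neg_mul, mul_assoc]

theorem dRed_thetaHat (i : Fin 3) : dRed (thetaHat i) = -(odd .vR * thetaUp i) := by
  simp only [thetaHat, thetaUp, map_sum, dRed_isOddDer _ _, dRed_odd, sig_odd, dRed_hat_mu,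
    reduceCtorEq, if_false, zero_mul, zero_add, neg_mul_neg, Finset.mul_sum]
  rw [← Finset.sum_neg_distrib]
  refine Finset.sum_congr rfl fun a _ => ?_
  rw [← mul_assoc, odd_anticomm, neg_mul, mul_assoc]

/-- The extra term arises because `λ̂ / |λ|²` is not holomorphic in `λ`. It lies in `redAlg`, so
modulo reduced forms `v̂_i` is still exact, and it is invisible to `contr`. -/
theorem dTw_etaHat (i : Fin 3) : dTw (etaHat i) = -(odd .vL * etaLow i) + evn (.vEta i) := by
  rw [dTw, LinearMap.add_apply, dRed_etaHat, dFerm_etaHat]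

theorem dTw_thetaHat (i : Fin 3) : dTw (thetaHat i) = -(odd .vR * thetaUp i) + evn (.vTheta i) := by
  rw [dTw, LinearMap.add_apply, dRed_thetaHat, dFerm_thetaHat]

theorem dTw_redAlg {x : Form} (hx : x ∈ redAlg) : dTw x ∈ redAlg := by
  rw [dTw, LinearMap.add_apply, dFerm_redAlg hx, add_zero]
  exact dRed_redAlg hx

/-! ### The contracting derivation -/

/-- The derivative with respect to a commuting generator, on raw forms. -/
def Raw.dEvn (j : EvenGen) : Raw.Form →ₗ[ℂ] Raw.Form :=
  (((MvPolynomial.pderiv j).toLinearMap : MvPolynomial EvenGen ℂ →ₗ[ℂ] _).lTensor _).rTensor _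

theorem Raw.dEvn_mul (j : EvenGen) (a b : Raw.Form) :
    Raw.dEvn j (a * b) = Raw.dEvn j a * b + a * Raw.dEvn j b := by
  induction a using TensorProduct.induction_on with
  | zero => simp
  | add x y hx hy => simp only [add_mul, map_add, hx, hy]; abel
  | tmul p f =>
    induction b using TensorProduct.induction_on with
    | zero => simp
    | add x y hx hy => simp only [mul_add, map_add, hx, hy]; abel
    | tmul q g =>
      induction p using TensorProduct.induction_on with
      | zero => simp
      | add x y hx hy => simp only [add_mul, map_add, TensorProduct.add_tmul, hx, hy]; abel
      | tmul x u =>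
        induction q using TensorProduct.induction_on with
        | zero => simp
        | add x y hx hy => simp only [mul_add, map_add, TensorProduct.add_tmul, hx, hy]; abel
        | tmul y v =>
          simp only [Raw.dEvn, Algebra.TensorProduct.tmul_mul_tmul, LinearMap.rTensor_tmul,
            LinearMap.lTensor_tmul, Derivation.coeFn_coe,
            Derivation.leibniz, smul_eq_mul, TensorProduct.tmul_add, TensorProduct.add_tmul]
          rw [add_comm, mul_comm v]

theorem Raw.dEvn_odd (j : EvenGen) (k : OddGen) : Raw.dEvn j (Raw.odd k) = 0 := by
  simp [Raw.dEvn, Raw.odd]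

theorem Raw.dEvn_fn (j : EvenGen) (f : Smooth) : Raw.dEvn j (Raw.fn f) = 0 := by
  simp [Raw.dEvn, Raw.fn, Algebra.TensorProduct.one_def]

open Classical in
theorem Raw.dEvn_evn (j k : EvenGen) : Raw.dEvn j (Raw.evn k) = if j = k then 1 else 0 := by
  by_cases h : j = k
  · subst h
    simp [Raw.dEvn, Raw.evn, Algebra.TensorProduct.one_def]
  · simp [Raw.dEvn, Raw.evn, h, MvPolynomial.pderiv_X_of_ne (Ne.symm h)]

/-- The derivative with respect to a commuting generator. -/
def dEvn : EvenGen → Form →ₗ[ℂ] Form := Raw.dEvn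

theorem dEvn_isEvenDer (j : EvenGen) : IsEvenDer (dEvn j) := Raw.dEvn_mul j

theorem dEvn_odd (j : EvenGen) (k : OddGen) : dEvn j (odd k) = 0 := Raw.dEvn_odd j k

theorem dEvn_fn (j : EvenGen) (f : Smooth) : dEvn j (fn f) = 0 := Raw.dEvn_fn j f

open Classical in
theorem dEvn_evn (j k : EvenGen) : dEvn j (evn k) = if j = k then 1 else 0 := Raw.dEvn_evn j k

/-- The odd derivation mapping the fermionic one-forms to the complementary fermionic coordinates and
the other generators to zero. -/
def contr : Form →ₗ[ℂ] Form :=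
  ∑ i, (lmul (etaHat i) (dEvn (.vEta i)) + lmul (thetaHat i) (dEvn (.vTheta i)))

theorem contr_isOddDer : IsOddDer contr :=
  .sum _ fun i => ((dEvn_isEvenDer _).lmul_odd (etaHat_mul i)).add
    ((dEvn_isEvenDer _).lmul_odd (thetaHat_mul i))

theorem contr_odd (k : OddGen) : contr (odd k) = 0 := by
  simp only [contr, LinearMap.sum_apply, LinearMap.add_apply, lmul_apply, dEvn_odd, mul_zero,
    add_zero, Finset.sum_const_zero]

theorem contr_fn (f : Smooth) : contr (fn f) = 0 := by
  simp only [contr, LinearMap.sum_apply, LinearMap.add_apply, lmul_apply, dEvn_fn, mul_zero,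
    add_zero, Finset.sum_const_zero]

theorem contr_vEta (i : Fin 3) : contr (evn (.vEta i)) = etaHat i := by
  simp [contr, lmul_apply, dEvn_evn]

theorem contr_vTheta (i : Fin 3) : contr (evn (.vTheta i)) = thetaHat i := by
  simp [contr, lmul_apply, dEvn_evn]

/-- One computation serves `etaLow`, `thetaUp`, `etaHat` and `thetaHat`, all of which are
combinations of odd generators with functions as coefficients. -/
theorem contr_sum_odd {ι : Type*} (s : Finset ι) (k : ι → OddGen) (f : ι → Smooth) :
    contr (∑ a ∈ s, odd (k a) * fn (f a)) = 0 := by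
  simp [contr_isOddDer _ _, contr_odd, contr_fn]

/-- The derivation `contr` acts only through the fermionic one-forms, and none of these occur among
the generators of `redAlg`. -/
theorem contr_redAlg {x : Form} (hx : x ∈ redAlg) : contr x = 0 := by
  refine redAlg_induction (C := fun x => contr x = 0) (contr_odd _) (contr_odd _) (contr_odd _)
    (fun i => contr_sum_odd _ _ _) (fun i => contr_sum_odd _ _ _) contr_fn
    (fun x _ y _ hx hy => ?_) (fun x _ y _ hx hy => ?_) hx
  · rw [map_add, hx, hy, add_zero]
  · rw [contr_isOddDer, hx, hy, zero_mul, mul_zero, add_zero]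

/-! ### Equivariance of the contracting derivation -/

theorem diag_sum_odd_mul_fn {c e φ} {x y z : ℂ} {k : Fin 2 → OddGen} {f : Fin 2 → Smooth}
    (hk : ∀ a, c (k a) = x) (hf : ∀ a, φ (f a) = y • f a) (h : x * y = z) :
    diag c e φ (∑ a, odd (k a) * fn (f a)) = z • ∑ a, odd (k a) * fn (f a) := by
  simp only [map_sum, map_mul, diag_odd, diag_fn, hk, hf, fn_smul, smul_mul_smul_comm, h,
    Finset.smul_sum]

/-- The antiholomorphic weight of `λ̂` cancels against that of `1/|λ|²`. What is left is the weight
of `v̂_i` under rescaling of `λ`, so replacing `v̂_i` by `etaHat i` preserves homogeneity. -/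
theorem scaleS_hat_lam_inv (t s : ℂˣ) (k : Fin 2) :
    scaleS t s (-(hat lam k * invLam)) = (t : ℂ)⁻¹ • -(hat lam k * invLam) := by
  have := conj_unit_ne t
  rw [map_neg, map_mul, scaleS_hat_lam, scaleS_invLam, smul_mul_smul_comm, smul_neg]
  congr 2
  field_simp

theorem scaleS_hat_mu_inv (t s : ℂˣ) (k : Fin 2) :
    scaleS t s (-(hat mu k * invMu)) = (s : ℂ)⁻¹ • -(hat mu k * invMu) := by
  have := conj_unit_ne s
  rw [map_neg, map_mul, scaleS_hat_mu, scaleS_invMu, smul_mul_smul_comm, smul_neg]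
  congr 2
  field_simp

theorem torus_etaHat (r t s : ℂˣ) (i : Fin 3) :
    torus r t s (etaHat i) = (t : ℂ)⁻¹ • etaHat i :=
  diag_sum_odd_mul_fn (x := 1) (fun _ => rfl) (scaleS_hat_lam_inv t s) (one_mul _)

theorem torus_thetaHat (r t s : ℂˣ) (i : Fin 3) :
    torus r t s (thetaHat i) = (s : ℂ)⁻¹ • thetaHat i :=
  diag_sum_odd_mul_fn (x := 1) (fun _ => rfl) (scaleS_hat_mu_inv t s) (one_mul _)

theorem parity_etaHat (i : Fin 3) : parity (etaHat i) = (-1 : ℂ) • etaHat i :=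
  diag_sum_odd_mul_fn (x := -1) (y := 1) (fun _ => rfl) (by simp) (mul_one _)

theorem parity_thetaHat (i : Fin 3) : parity (thetaHat i) = (-1 : ℂ) • thetaHat i :=
  diag_sum_odd_mul_fn (x := -1) (y := 1) (fun _ => rfl) (by simp) (mul_one _)

/-- The factor `r⁻¹` records that `contr` lowers the form degree by one; the weights in `t` and `s`
agree on both sides of the substitution. -/
theorem torus_contr (r t s : ℂˣ) (a : Form) :
    torus r t s (contr a) = (r : ℂ)⁻¹ • contr (torus r t s a) := by
  have hr := r.ne_zero
  refine contr_isOddDer.diag _ _ _ _ (fun k => ?_) (fun k => ?_) (fun f => ?_) a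
  · rw [diag_odd, map_smul, contr_odd]; simp
  · cases k with
    | vEta i =>
      rw [diag_evn, map_smul, contr_vEta, smul_smul]
      refine (torus_etaHat r t s i).trans ?_
      congr 1
      field_simp
    | vTheta i =>
      rw [diag_evn, map_smul, contr_vTheta, smul_smul]
      refine (torus_thetaHat r t s i).trans ?_
      congr 1
      field_simp
  · rw [diag_fn, contr_fn, contr_fn]; simp

theorem parity_contr (a : Form) : parity (contr a) = contr (parity a) := by
  refine (contr_isOddDer.diag 1 _ _ _ (fun k => ?_) (fun k => ?_) (fun f => ?_) a).trans
    (one_smul _ _)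
  · rw [diag_odd, map_smul, contr_odd]; simp
  · cases k with
    | vEta i => rw [diag_evn, map_smul, contr_vEta, one_smul]; exact parity_etaHat i
    | vTheta i => rw [diag_evn, map_smul, contr_vTheta, one_smul]; exact parity_thetaHat i
  · rw [diag_fn, contr_fn, contr_fn]; simp

/-- The total parity is the parity automorphism followed by the torus element `r = -1`. The first
commutes with `contr` and the second contributes `r⁻¹ = -1`. -/
theorem sig_contr (a : Form) : sig (contr a) = -contr (sig a) := by
  rw [← sig_eq, ← sig_eq, parity_contr, torus_contr]
  simp

/-! ### The counting operator -/

/-- The anticommutator of the differential and the contracting derivation. -/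
def count : Module.End ℂ Form := dTw ∘ₗ contr + contr ∘ₗ dTw

theorem count_apply (a : Form) : count a = dTw (contr a) + contr (dTw a) := rfl

/-- The anticommutator of two odd derivations is an even derivation: since both anticommute with
`sig`, the mixed terms cancel in pairs. -/
theorem count_isEvenDer : IsEvenDer count := fun a b => by
  simp only [count_apply, dTw_isOddDer _ _, contr_isOddDer _ _, map_add, sig_sig, sig_contr, sig_dTw,
    neg_mul, add_mul, mul_add]
  abel

/-- Both sides equal `dTw ∘ contr ∘ dTw`, because `dTw` squares to zero. -/
theorem dTw_count (a : Form) : dTw (count a) = count (dTw a) := by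
  simp only [count_apply, map_add, dTw_dTw, map_zero, add_zero, zero_add]

theorem torus_count (r t s : ℂˣ) (a : Form) : torus r t s (count a) = count (torus r t s a) := by
  have hr := r.ne_zero
  simp only [count_apply, map_add, torus_dTw, torus_contr, map_smul, smul_smul, mul_inv_cancel₀ hr,
    inv_mul_cancel₀ hr, one_smul]

theorem parity_count (a : Form) : parity (count a) = count (parity a) := by
  simp only [count_apply, map_add, parity_dTw, parity_contr]

/-- The reduced forms are stable under `dTw` and annihilated by `contr`, so both terms of the
anticommutator vanish. -/
theorem count_redAlg {x : Form} (hx : x ∈ redAlg) : count x = 0 := by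
  rw [count_apply, contr_redAlg hx, contr_redAlg (dTw_redAlg hx), map_zero, add_zero]

theorem contr_etaHat (i : Fin 3) : contr (etaHat i) = 0 := contr_sum_odd _ _ _

theorem contr_thetaHat (i : Fin 3) : contr (thetaHat i) = 0 := contr_sum_odd _ _ _

theorem vL_etaLow_mem (i : Fin 3) : -(odd .vL * etaLow i) ∈ redAlg :=
  neg_mem (mul_mem vL_mem (etaLow_mem i))

theorem vR_thetaUp_mem (i : Fin 3) : -(odd .vR * thetaUp i) ∈ redAlg :=
  neg_mem (mul_mem vR_mem (thetaUp_mem i))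

/-- Applying `contr` to `dTw (etaHat i)` kills the reduced term and turns `v̂_i` back into `etaHat
i`. The generator `v̂_i` itself is not chosen as an eigenvector, since `count` sends it to `dTw
(etaHat i)`; this form is the eigenvector that replaces it. -/
theorem count_etaHat (i : Fin 3) : count (etaHat i) = etaHat i := by
  rw [count_apply, contr_etaHat, dTw_etaHat, map_add, contr_redAlg (vL_etaLow_mem i), contr_vEta,
    map_zero, zero_add, zero_add]

theorem count_thetaHat (i : Fin 3) : count (thetaHat i) = thetaHat i := by
  rw [count_apply, contr_thetaHat, dTw_thetaHat, map_add, contr_redAlg (vR_thetaUp_mem i),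
    contr_vTheta, map_zero, zero_add, zero_add]

/-! ### Splitting of the forms into reduced forms and positive eigenvectors -/

/-- The sum of the eigenspaces of the counting operator for positive integers. -/
def posPart : Submodule ℂ Form := ⨆ n : ℕ, count.eigenspace (n + 1 : ℂ)

theorem mem_posPart_of_count {x : Form} (n : ℕ) (h : count x = (n + 1 : ℂ) • x) : x ∈ posPart :=
  (le_iSup (fun n : ℕ => count.eigenspace (n + 1 : ℂ)) n) (Module.End.mem_eigenspace_iff.2 h)

theorem posPart_induction {C : Form → Prop}
    (heig : ∀ (n : ℕ) x, count x = (n + 1 : ℂ) • x → C x) (hadd : ∀ x y, C x → C y → C (x + y))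
    {x : Form} (hx : x ∈ posPart) : C x :=
  Submodule.iSup_induction _ (motive := C) hx (fun n x hx => heig n x (Module.End.mem_eigenspace_iff.1 hx))
    -- The zero case of the induction needs no separate hypothesis: zero satisfies every eigenvector
    -- equation.
    (heig 0 0 (by simp)) hadd

/-- An operator commuting with `count` preserves each of its eigenspaces. -/
theorem map_mem_posPart {D : Form →ₗ[ℂ] Form} (hD : ∀ a, D (count a) = count (D a)) {x : Form}
    (hx : x ∈ posPart) : D x ∈ posPart :=
  posPart_induction (C := fun x => D x ∈ posPart)
    (fun n x h => mem_posPart_of_count n (by rw [← hD, h, map_smul]))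
    (fun x y hx hy => by rw [map_add]; exact add_mem hx hy) hx

theorem mul_mem_posPart {x y : Form} (hx : x ∈ posPart) (hy : y ∈ posPart) : x * y ∈ posPart := by
  refine posPart_induction (C := fun x => x * y ∈ posPart) (fun m x hx => ?_)
    (fun x x' hx hx' => by rw [add_mul]; exact add_mem hx hx') hx
  refine posPart_induction (C := fun y => x * y ∈ posPart) (fun n y hy => ?_)
    (fun y y' hy hy' => by rw [mul_add]; exact add_mem hy hy') hy
  -- Eigenvalues of an even derivation add under products: `(m + 1) + (n + 1) = (m + n + 1) + 1`.
  refine mem_posPart_of_count (m + n + 1) ?_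
  rw [count_isEvenDer, hx, hy, smul_mul_assoc, mul_smul_comm, ← add_smul]
  push_cast
  congr 1
  ring

/-- Reduced forms have eigenvalue zero, so multiplying by them leaves eigenvalues unchanged. -/
theorem redAlg_mul_mem_posPart {x y : Form} (hx : x ∈ redAlg) (hy : y ∈ posPart) :
    x * y ∈ posPart :=
  posPart_induction (C := fun y => x * y ∈ posPart)
    (fun n y hy => mem_posPart_of_count n (by
      rw [count_isEvenDer, count_redAlg hx, hy, zero_mul, zero_add, mul_smul_comm]))
    (fun y y' hy hy' => by rw [mul_add]; exact add_mem hy hy') hy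

theorem mul_redAlg_mem_posPart {x y : Form} (hx : x ∈ posPart) (hy : y ∈ redAlg) :
    x * y ∈ posPart :=
  posPart_induction (C := fun x => x * y ∈ posPart)
    (fun n x hx => mem_posPart_of_count n (by
      rw [count_isEvenDer, count_redAlg hy, hx, mul_zero, add_zero, smul_mul_assoc]))
    (fun y y' hy hy' => by rw [add_mul]; exact add_mem hy hy') hx

theorem etaHat_mem (i : Fin 3) : etaHat i ∈ posPart :=
  mem_posPart_of_count 0 (by simp [count_etaHat])

theorem thetaHat_mem (i : Fin 3) : thetaHat i ∈ posPart :=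
  mem_posPart_of_count 0 (by simp [count_thetaHat])

theorem dTw_mem_posPart {x : Form} (hx : x ∈ posPart) : dTw x ∈ posPart :=
  map_mem_posPart dTw_count hx

/-- The sum of `redAlg` and `posPart` is closed under products by the additivity of eigenvalues, so
it suffices to find every generator in it. -/
theorem exists_redAlg_add_posPart (a : Form) : ∃ x ∈ redAlg, ∃ y ∈ posPart, x + y = a := by
  induction a using form_induction with
  | hodd k =>
    cases k with
    | vF => exact ⟨_, vF_mem, 0, zero_mem _, add_zero _⟩
    | vL => exact ⟨_, vL_mem, 0, zero_mem _, add_zero _⟩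
    | vR => exact ⟨_, vR_mem, 0, zero_mem _, add_zero _⟩
    | eta a i =>
      -- Spinor completeness splits `η^α_i` into a multiple of `η_i`, which is reduced, and a
      -- multiple of `etaHat i`, which has eigenvalue one.
      exact ⟨_, mul_mem (etaLow_mem i) (fn_mem _), _, mul_redAlg_mem_posPart (etaHat_mem i) (fn_mem _),
        (odd_eta_eq a i).symm⟩
    | theta i a =>
      exact ⟨_, mul_mem (thetaUp_mem i) (fn_mem _), _,
        mul_redAlg_mem_posPart (thetaHat_mem i) (fn_mem _), (odd_theta_eq i a).symm⟩
  | hevn k =>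
    cases k with
    | vEta i =>
      -- Here `v̂_i = v̂^L η_i + dTw (etaHat i)`, and the exact summand stays in `posPart` because
      -- `dTw` commutes with `count`.
      exact ⟨_, neg_mem (vL_etaLow_mem i), _, dTw_mem_posPart (etaHat_mem i),
        by rw [dTw_etaHat, neg_add_cancel_left]⟩
    | vTheta i =>
      exact ⟨_, neg_mem (vR_thetaUp_mem i), _, dTw_mem_posPart (thetaHat_mem i),
        by rw [dTw_thetaHat, neg_add_cancel_left]⟩
  | hfn f => exact ⟨_, fn_mem f, 0, zero_mem _, add_zero _⟩
  | hmul a b ha hb =>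
    obtain ⟨x, hx, y, hy, rfl⟩ := ha
    obtain ⟨x', hx', y', hy', rfl⟩ := hb
    refine ⟨x * x', mul_mem hx hx', x * y' + y * x' + y * y', add_mem (add_mem ?_ ?_) ?_, ?_⟩
    · exact redAlg_mul_mem_posPart hx hy'
    · exact mul_redAlg_mem_posPart hy hx'
    · exact mul_mem_posPart hy hy'
    · simp only [mul_add, add_mul]; abel
  | hadd a b ha hb =>
    obtain ⟨x, hx, y, hy, rfl⟩ := ha
    obtain ⟨x', hx', y', hy', rfl⟩ := hb
    exact ⟨x + x', add_mem hx hx', y + y', add_mem hy hy', by abel⟩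

/-- Eigenspaces for distinct eigenvalues are independent, and in characteristic zero no `n + 1`
equals the eigenvalue `0`. -/
theorem eq_zero_of_count_eq_zero {x : Form} (hx : x ∈ posPart) (h : count x = 0) : x = 0 := by
  have hi := count.eigenspaces_iSupIndep (0 : ℂ)
  refine (Submodule.disjoint_def.1 hi) x (Module.End.mem_eigenspace_iff.2 (by simpa using h)) ?_
  refine (iSup_le fun n => ?_ : posPart ≤ _) hx
  exact le_iSup₂_of_le (n + 1 : ℂ) (Nat.cast_add_one_ne_zero n) le_rfl

theorem isCompl_redAlg_posPart : IsCompl posPart (Subalgebra.toSubmodule redAlg) := by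
  refine ⟨Submodule.disjoint_def.2 fun x hx hx' => eq_zero_of_count_eq_zero hx (count_redAlg hx'), ?_⟩
  rw [codisjoint_iff, eq_top_iff]
  intro a _
  obtain ⟨x, hx, y, hy, rfl⟩ := exists_redAlg_add_posPart a
  exact add_mem (Submodule.mem_sup_right hx) (Submodule.mem_sup_left hy)

/-! ### The partial inverse of the counting operator -/

/-- The counting operator on its positive part is invertible. -/
def countEquiv : posPart ≃ₗ[ℂ] posPart :=
  LinearEquiv.ofBijective (count.restrict fun _ hx => map_mem_posPart (fun _ => rfl) hx) <| by
    refine ⟨(injective_iff_map_eq_zero _).2 fun x hx => ?_, fun ⟨y, hy⟩ => ?_⟩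
    · exact Subtype.ext (eq_zero_of_count_eq_zero x.2 (congrArg Subtype.val hx))
    · have : ∃ x ∈ posPart, count x = y := by
        refine posPart_induction (C := fun y => ∃ x ∈ posPart, count x = y) (fun n y hy => ?_) ?_ hy
        -- A preimage of an eigenvector is that vector divided by its eigenvalue.
        · refine ⟨(n + 1 : ℂ)⁻¹ • y, Submodule.smul_mem _ _ (mem_posPart_of_count n hy), ?_⟩
          rw [map_smul, hy, inv_smul_smul₀ (Nat.cast_add_one_ne_zero n)]
        · rintro _ _ ⟨x, hx, rfl⟩ ⟨y, hy, rfl⟩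
          exact ⟨x + y, add_mem hx hy, map_add _ _ _⟩
      obtain ⟨x, hx, rfl⟩ := this
      exact ⟨⟨x, hx⟩, rfl⟩

/-- The partial inverse of the counting operator, vanishing on the reduced forms. -/
def countInv : Form →ₗ[ℂ] Form :=
  posPart.subtype ∘ₗ countEquiv.symm.toLinearMap ∘ₗ
    posPart.projectionOnto _ isCompl_redAlg_posPart

theorem countInv_redAlg {x : Form} (hx : x ∈ redAlg) : countInv x = 0 := by
  have : posPart.projectionOnto _ isCompl_redAlg_posPart x = 0 :=
    (Submodule.projectionOnto_apply_eq_zero_iff _).2 hx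
  simp [countInv, this]

theorem countInv_count {x : Form} (hx : x ∈ posPart) : countInv (count x) = x := by
  have : posPart.projectionOnto _ isCompl_redAlg_posPart (count x) = countEquiv ⟨x, hx⟩ :=
    Submodule.projectionOnto_apply_of_mem_left _ (map_mem_posPart (fun _ => rfl) hx)
  simp [countInv, this]

/-- In this normal form `countInv` can be read off: it sends `x + count y` to `y`. Identities
involving `countInv` are checked on such sums. -/
theorem exists_redAlg_add_count (a : Form) : ∃ x ∈ redAlg, ∃ y ∈ posPart, x + count y = a := by
  obtain ⟨x, hx, y, hy, rfl⟩ := exists_redAlg_add_posPart a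
  obtain ⟨z, hz⟩ := countEquiv.surjective ⟨y, hy⟩
  exact ⟨x, hx, z, z.2, congrArg (x + ·) (congrArg Subtype.val hz)⟩

/-- Operators preserving the reduced forms and commuting with the counting operator commute with its
partial inverse. -/
theorem map_countInv {D : Form →ₗ[ℂ] Form} (hD : ∀ a, D (count a) = count (D a))
    (hr : ∀ x ∈ redAlg, D x ∈ redAlg) (a : Form) : D (countInv a) = countInv (D a) := by
  obtain ⟨x, hx, y, hy, rfl⟩ := exists_redAlg_add_count a
  simp only [map_add, countInv_redAlg hx, countInv_redAlg (hr x hx), countInv_count hy, hD,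
    countInv_count (map_mem_posPart hD hy), zero_add]

/-- The operator `count ∘ countInv` is the projection onto `posPart` along `redAlg`, so the
difference is the reduced component. -/
theorem sub_count_countInv_mem (a : Form) : a - count (countInv a) ∈ redAlg := by
  obtain ⟨x, hx, y, hy, rfl⟩ := exists_redAlg_add_count a
  rwa [map_add, countInv_redAlg hx, countInv_count hy, zero_add, add_sub_cancel_right]

/-! ### Compatibility of the partial inverse with differential, degree, homogeneity and parity -/

/-- Each generator of `redAlg` is rescaled, and functions go to functions. Notably `η_i` and `θ^i`
are weight vectors. This is the stability hypothesis of `map_countInv`. -/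
theorem torus_redAlg (r t s : ℂˣ) {x : Form} (hx : x ∈ redAlg) : torus r t s x ∈ redAlg := by
  refine redAlg_induction (C := fun x => torus r t s x ∈ redAlg) ?_ ?_ ?_ (fun i => ?_)
    (fun i => ?_) (fun f => ?_) (fun x _ y _ hx hy => ?_) (fun x _ y _ hx hy => ?_) hx
  · rw [torus, diag_odd]; exact Subalgebra.smul_mem _ vF_mem _
  · rw [torus, diag_odd]; exact Subalgebra.smul_mem _ vL_mem _
  · rw [torus, diag_odd]; exact Subalgebra.smul_mem _ vR_mem _
  · rw [(torus_thetaEta r t s).1]; exact Subalgebra.smul_mem _ (etaLow_mem i) _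
  · rw [(torus_thetaEta r t s).2.1]; exact Subalgebra.smul_mem _ (thetaUp_mem i) _
  · rw [torus, diag_fn]; exact fn_mem _
  · rw [map_add]; exact add_mem hx hy
  · rw [map_mul]; exact mul_mem hx hy

theorem parity_redAlg {x : Form} (hx : x ∈ redAlg) : parity x ∈ redAlg := by
  refine redAlg_induction (C := fun x => parity x ∈ redAlg) ?_ ?_ ?_ (fun i => ?_)
    (fun i => ?_) (fun f => ?_) (fun x _ y _ hx hy => ?_) (fun x _ y _ hx hy => ?_) hx
  · rw [parity, diag_odd]; exact Subalgebra.smul_mem _ vF_mem _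
  · rw [parity, diag_odd]; exact Subalgebra.smul_mem _ vL_mem _
  · rw [parity, diag_odd]; exact Subalgebra.smul_mem _ vR_mem _
  · rw [parity_thetaEta.1]; exact Subalgebra.smul_mem _ (etaLow_mem i) _
  · rw [parity_thetaEta.2.1]; exact Subalgebra.smul_mem _ (thetaUp_mem i) _
  · rw [parity, diag_fn]; exact fn_mem _
  · rw [map_add]; exact add_mem hx hy
  · rw [map_mul]; exact mul_mem hx hy

theorem dTw_countInv (a : Form) : dTw (countInv a) = countInv (dTw a) :=
  map_countInv dTw_count (fun _ => dTw_redAlg) a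

theorem torus_countInv (r t s : ℂˣ) (a : Form) :
    torus r t s (countInv a) = countInv (torus r t s a) :=
  map_countInv (D := (torus r t s).toLinearMap) (torus_count r t s)
    (fun _ => torus_redAlg r t s) a

theorem parity_countInv (a : Form) : parity (countInv a) = countInv (parity a) :=
  map_countInv (D := parity.toLinearMap) parity_count (fun _ => parity_redAlg) a

/-- Membership in `Omega` is an eigenvector condition for the torus and parity actions, which
commute with `countInv`; hence the homotopy stays within globally defined forms. -/
theorem countInv_mem_Omega {p a} {x : Form} (hx : x ∈ Omega p a) : countInv x ∈ Omega p a :=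
  ⟨fun r t s => by rw [torus_countInv, hx.1, map_smul], by rw [parity_countInv, hx.2, map_smul]⟩

theorem contr_mem_Omega {p a} {x : Form} (hx : x ∈ Omega (p + 1) a) : contr x ∈ Omega p a :=
  ⟨fun r t s => by
    rw [torus_contr, hx.1, map_smul, smul_smul, pow_succ', inv_mul_cancel_left₀ r.ne_zero],
    by rw [parity_contr, hx.2, map_smul]⟩

theorem count_mem_Omega {p a} {x : Form} (hx : x ∈ Omega p a) : count x ∈ Omega p a :=
  ⟨fun r t s => by rw [torus_count, hx.1, map_smul], by rw [parity_count, hx.2, map_smul]⟩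

/-! ### Forms of negative degree vanish -/

/-- Scalars are regarded here as constant functions, so that polynomials with forms as coefficients
can be evaluated at them. -/
theorem fn_algebraMap_pow (r : ℂ) (n : ℕ) :
    fn (algebraMap ℂ Smooth r) ^ n = r ^ n • (1 : Form) := by
  rw [← mul_one (fn _), ← smul_eq_fn_mul, smul_pow, one_pow]

/-- Every form is a sum of forms of non-negative degrees. -/
theorem exists_torus_eq_eval (a : Form) :
    ∃ q : Polynomial Form, ∀ r : ℂˣ, torus r 1 1 a = q.eval (fn (algebraMap ℂ Smooth r)) := by
  have key : ∀ (x : Form) (n : ℕ), (∀ r : ℂˣ, torus r 1 1 x = (r : ℂ) ^ n • x) →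
      ∃ q : Polynomial Form, ∀ r : ℂˣ, torus r 1 1 x = q.eval (fn (algebraMap ℂ Smooth r)) :=
    fun x n h => ⟨Polynomial.monomial n x, fun r => by
      rw [h, Polynomial.eval_monomial, fn_algebraMap_pow, mul_smul_comm, mul_one]⟩
  induction a using form_induction with
  | hodd k =>
    cases k with
    | vF => exact key _ 1 fun r => by rw [torus, diag_odd]; simp
    | vL => exact key _ 1 fun r => by rw [torus, diag_odd]; simp
    | vR => exact key _ 1 fun r => by rw [torus, diag_odd]; simp
    | eta a i => exact key _ 0 fun r => by rw [torus, diag_odd]; simp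
    | theta i a => exact key _ 0 fun r => by rw [torus, diag_odd]; simp
  | hevn k => cases k <;> exact key _ 1 fun r => by rw [torus, diag_evn]; simp
  | hfn f =>
    refine key _ 0 fun r => ?_
    rw [torus, diag_fn, pow_zero, one_smul]
    congr 1
    ext p
    change (f : cone → ℂ) _ = (f : cone → ℂ) p
    exact congrArg _ (Subtype.ext (by simp [scaleL_apply]))
  | hmul a b ha hb =>
    obtain ⟨q, hq⟩ := ha
    obtain ⟨q', hq'⟩ := hb
    exact ⟨q * q', fun r => by
      rw [map_mul, hq, hq']
      -- The algebra `Form` is not commutative, but evaluation is multiplicative because the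
      -- evaluation point is a function and hence central.
      exact (Polynomial.eval₂_mul_noncomm _ _ fun k => (fn_comm _ _).symm).symm⟩
  | hadd a b ha hb =>
    obtain ⟨q, hq⟩ := ha
    obtain ⟨q', hq'⟩ := hb
    exact ⟨q + q', fun r => by rw [map_add, hq, hq', Polynomial.eval_add]⟩

/-- The scaling action depends polynomially on `r`, which excludes the weight `r⁻¹`. Testing against
linear functionals reduces this to scalar polynomials. -/
theorem eq_zero_of_torus_inv {a : Form} (h : ∀ r : ℂˣ, torus r 1 1 a = (r : ℂ)⁻¹ • a) : a = 0 := by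
  obtain ⟨p, hp⟩ := exists_torus_eq_eval a
  refine (Module.forall_dual_apply_eq_zero_iff ℂ a).1 fun φ => ?_
  -- Multiplying `r⁻¹ φ(a) = P(r)` by `r` gives a polynomial identity valid for all `r ≠ 0`, so `q =
  -- X P - φ(a)` has infinitely many roots.
  let q : Polynomial ℂ :=
    Polynomial.X * ∑ k ∈ Finset.range (p.natDegree + 1), Polynomial.monomial k (φ (p.coeff k)) -
      Polynomial.C (φ a)
  have hq : q = 0 := by
    refine Polynomial.eq_zero_of_infinite_isRoot q ((Set.finite_singleton (0 : ℂ)).infinite_compl.mono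
      fun r (hr : r ≠ 0) => ?_)
    have h1 := congrArg φ ((h (Units.mk0 r hr)).symm.trans (hp _))
    simp only [Units.val_mk0, map_smul, map_sum, smul_eq_mul, Polynomial.eval_eq_sum_range,
      fn_algebraMap_pow, mul_smul_comm, mul_one] at h1
    simp only [q, Set.mem_ofPred_eq, Polynomial.IsRoot, Polynomial.eval_sub, Polynomial.eval_mul,
      Polynomial.eval_X, Polynomial.eval_finsetSum, Polynomial.eval_monomial, Polynomial.eval_C]
    rw [Finset.sum_congr rfl fun k _ => mul_comm (φ (p.coeff k)) (r ^ k), ← h1, mul_inv_cancel_left₀ hr,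
      sub_self]
  -- Since `q` vanishes identically it may be evaluated at the excluded point `0`, where the factor
  -- `X` leaves only `-φ(a)`.
  simpa [q] using congrArg (Polynomial.eval 0) hq

/-- The result would be a form of degree `-1`. -/
theorem contr_Omega_zero {a} {x : Form} (hx : x ∈ Omega 0 a) : contr x = 0 :=
  eq_zero_of_torus_inv fun r => by rw [torus_contr, hx.1, pow_zero, one_smul]

/-! ### The inclusion is a homotopy equivalence -/

open CategoryTheory

/-- A morphism of differential graded Lie superalgebras with a retraction of the underlying complexes
which is an inverse up to homotopy is a quasi-isomorphism. -/
theorem DGLieSuperalgebra.Hom.isQuasiIso_of_homotopy {L M : DGLieSuperalgebra.{u}} (f : L.Hom M)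
    (ret : ∀ p a, M.X p a →ₗ[ℂ] L.X p a) (hty : ∀ p a, M.X (p + 1) a →ₗ[ℂ] M.X p a)
    (ret_d : ∀ p a x, ret (p + 1) a (M.d p a x) = L.d p a (ret p a x))
    (ret_f : ∀ p a x, ret p a (f.toFun p a x) = x)
    (hty_zero : ∀ a x, hty 0 a (M.d 0 a x) = x - f.toFun 0 a (ret 0 a x))
    (hty_succ : ∀ p a x, M.d p a (hty p a x) + hty (p + 1) a (M.d (p + 1) a x) =
      x - f.toFun (p + 1) a (ret (p + 1) a x)) : f.IsQuasiIso := by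
  intro a
  let r : M.complex a ⟶ L.complex a :=
    CochainComplex.ofHom (fun p => ModuleCat.ofHom (ret p a)) fun p => by
      rw [complex_d, complex_d]
      ext x
      exact (ret_d p a x).symm
  let h : ∀ i j, (ComplexShape.up ℕ).Rel j i → ((M.complex a).X i ⟶ (M.complex a).X j) :=
    -- The relation says `j + 1 = i`, so the homotopy lowers the degree by one.
    fun i j hij => by
      subst hij
      exact ModuleCat.ofHom (hty j a)
  have hnull : Homotopy.nullHomotopicMap' h = 𝟙 _ - r ≫ f.complexMap a := by
    ext p : 1
    cases p with
    | zero =>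
      -- Nothing maps into degree zero, so only the summand formed from the outgoing differential
      -- remains there.
      rw [Homotopy.nullHomotopicMap'_f_of_not_rel_right (k₁ := 0) (k₀ := 1) rfl
        (fun l => Nat.succ_ne_zero l), complex_d]
      ext x
      exact hty_zero a x
    | succ p =>
      rw [Homotopy.nullHomotopicMap'_f (k₂ := p) (k₀ := p + 2) rfl rfl, complex_d, complex_d]
      ext x
      exact (add_comm _ _).trans (hty_succ p a x)
  let e : HomotopyEquiv (L.complex a) (M.complex a) :=
    { hom := f.complexMap a
      inv := r
      -- The retraction is a strict left inverse of the morphism; only the other composite needs a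
      -- homotopy.
      homotopyHomInvId := Homotopy.ofEq (by ext p x; exact ret_f p a x)
      homotopyInvHomId :=
        (Homotopy.equivSubZero.symm
          ((Homotopy.ofEq hnull.symm).trans (Homotopy.nullHomotopy' h))).symm }
  exact HomotopyEquiv.quasiIso_hom e

/-! ### The deformation retraction of the twisted forms onto the reduced forms -/

/-- The inclusion of the reduced forms of given degree and parity. -/
def formsInclusion (p : ℕ) (a : ZMod 2) : redForms.carrier p a →ₗ[ℂ] twForms.carrier p a :=
  Submodule.inclusion inf_le_left

/-- The projection of forms of given degree and parity onto the reduced forms. -/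
def retract (p : ℕ) (a : ZMod 2) : twForms.carrier p a →ₗ[ℂ] redForms.carrier p a :=
  (LinearMap.id - count ∘ₗ countInv).restrict fun x hx =>
    ⟨sub_mem hx (count_mem_Omega (countInv_mem_Omega hx)), sub_count_countInv_mem x⟩

/-- The contracting homotopy. -/
def homotopy (p : ℕ) (a : ZMod 2) :
    twForms.carrier (p + 1) a →ₗ[ℂ] twForms.carrier p a :=
  (contr ∘ₗ countInv).restrict fun _ hx => contr_mem_Omega (countInv_mem_Omega hx)

/-- The projection commutes with `dTw` because `count` and `countInv` do. Its values are reduced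
forms, on which `dFerm` vanishes and `dTw` equals `dRed`. -/
theorem retract_der (p : ℕ) (a : ZMod 2) :
    retract (p + 1) a ∘ₗ twForms.der p a = redForms.der p a ∘ₗ retract p a := by
  ext x
  change dTw (x : Form) - count (countInv (dTw x)) = dRed ((x : Form) - count (countInv x))
  have h : dFerm ((x : Form) - count (countInv x)) = 0 := dFerm_redAlg (sub_count_countInv_mem _)
  rw [← add_zero (dRed _), ← h, ← dTw_countInv, ← dTw_count, ← map_sub]
  rfl

theorem retract_inclusion (p : ℕ) (a : ZMod 2) :
    retract p a ∘ₗ formsInclusion p a = LinearMap.id := by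
  ext x
  change (x : Form) - count (countInv x) = x
  rw [countInv_redAlg x.2.2, map_zero, sub_zero]

/-- In degree zero the term `dTw ∘ contr` of `count` drops out by `contr_Omega_zero`, which leaves
only the homotopy applied after the differential. -/
theorem homotopy_zero (a : ZMod 2) : homotopy 0 a ∘ₗ twForms.der 0 a =
    LinearMap.id - formsInclusion 0 a ∘ₗ retract 0 a := by
  ext x
  change contr (countInv (dTw x)) = (x : Form) - (x - count (countInv x))
  rw [sub_sub_cancel, count_apply, contr_Omega_zero (countInv_mem_Omega x.2), map_zero, zero_add,
    dTw_countInv]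

/-- As `countInv` commutes with `dTw`, the left side is the anticommutator `count` applied to
`countInv x`, which is the component of `x` in `posPart`. -/
theorem homotopy_succ (p : ℕ) (a : ZMod 2) :
    twForms.der p a ∘ₗ homotopy p a + homotopy (p + 1) a ∘ₗ twForms.der (p + 1) a =
      LinearMap.id - formsInclusion (p + 1) a ∘ₗ retract (p + 1) a := by
  ext x
  change dTw (contr (countInv x)) + contr (countInv (dTw x)) = (x : Form) - (x - count (countInv x))
  rw [sub_sub_cancel, count_apply, dTw_countInv]

end CRAmbitwistor

end

/-- The inclusion of the reduced forms is a quasi-isomorphism of differential graded Lie superalgebras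
between the reduced and the full twisted CR forms with values in a Lie algebra. -/
theorem mainTheorem4 (g : Type*) [LieRing g] [LieAlgebra ℂ g] :
    (CRAmbitwistor.wittenInclusion g).IsQuasiIso := by
  open CRAmbitwistor in
  refine DGLieSuperalgebra.Hom.isQuasiIso_of_homotopy _ (fun p a => (retract p a).rTensor g)
    (fun p a => (homotopy p a).rTensor g) (fun p a x => ?_) (fun p a x => ?_) (fun a x => ?_)
    (fun p a x => ?_)
  -- Tensoring with `g` is additive and functorial, so each identity between maps of forms carries
  -- over to `g`-valued forms; no exactness is required.
  · have h := congrArg (LinearMap.rTensor g) (retract_der p a)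
    rw [LinearMap.rTensor_comp, LinearMap.rTensor_comp] at h
    exact LinearMap.congr_fun h x
  · have h := congrArg (LinearMap.rTensor g) (retract_inclusion p a)
    rw [LinearMap.rTensor_comp, LinearMap.rTensor_id] at h
    exact LinearMap.congr_fun h x
  · have h := congrArg (LinearMap.rTensor g) (homotopy_zero a)
    rw [LinearMap.rTensor_comp, LinearMap.rTensor_sub, LinearMap.rTensor_comp,
      LinearMap.rTensor_id] at h
    exact LinearMap.congr_fun h x
  · have h := congrArg (LinearMap.rTensor g) (homotopy_succ p a)
    rw [LinearMap.rTensor_add, LinearMap.rTensor_comp, LinearMap.rTensor_comp, LinearMap.rTensor_sub,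
      LinearMap.rTensor_comp, LinearMap.rTensor_id] at h
    exact LinearMap.congr_fun h x
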